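/- **Model.** Fix reals $\alpha>2$, $\mathcal N>0$, $\beta\ge 1$, $0<\varepsilon<1$, $P>0$, and let $r=(P/(\mathcal N\beta))^{1/\alpha}$. A network consists of $n$ nodes at distinct points of the Euclidean plane, with distinct names in $\{1,\dots,N\}$. Rounds are synchronous. If exactly the nodes of a set $T$ transmit in a round, then a node $u\notin T$ receives the message of $v\in T$ if and only if $\mathrm{dist}(v,u)\le(1-\varepsilon)r$ and $$\frac{P\,\mathrm{dist}(v,u)^{-\alpha}}{\mathcal N+\sum_{w\in T\setminus\{v\}}P\,\mathrm{dist}(w,u)^{-\alpha}}\ \ge\ \beta .$$ In the communication graph two distinct nodes are adjacent if and only if their distance is at most $(1-\varepsilon)r$; $\Delta$ is its maximum degree, and we assume $\Delta\ge 2$. Each node knows its own name, $N$ and $\Delta$. All logarithms are to base $2$. **Strongly selective families.** A family $S=(S_0,\dots,S_{s-1})$ of subsets of $\{1,\dots,N\}$ is an $(N,x)$-ssf of length $s$ if for every non-empty $Z\subseteq\{1,\dots,N\}$ with $|Z|\le x$ and every $z\in Z$ there is an $i$ with $S_i\cap Z=\{z\}$. A set of nodes executes $S$ in $s$ rounds: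 in round $i$ those of its nodes whose names lie in $S_i$ transmit their names. **Procedure Mis_SWD** (with constants $a,b,L>0$ and an $(N,\lceil b\log^3N\rceil)$-ssf $S$ of length at most $L\log^7N$). All nodes start simultaneously, with status worker. Let $2^k$ be $\Delta$ rounded up to a power of $2$. There are phases $i=0,1,\dots,k$, each consisting of $\lceil a\log N\rceil$ sub-phases. A sub-phase has two stages. 1. Each worker becomes a candidate with probability $2^i/2^k$, independently of all other random choices. The candidates execute $S$. At the end, a candidate that heard no other candidate in this stage becomes a leader, and every other candidate becomes a worker again. 2. The nodes that became leaders in the preceding Stage 1 execute $S$. At the end, each worker that heard at least one name in this stage becomes a slave, and its master is the leader with the smallest name heard. Leaders and slaves keep their status forever. **Theorem.** For all $\alpha,\mathcal N,\beta,\varepsilon,P$ as above there are constants $a,b,L,C>0$ such that for every $N\ge 2$ an $(N,\lceil b\log^3N\rceil)$-ssf of length at most $L\log^7N$ exists and, for every such family $S$ and every network with $n$ nodes, names in $\{1,\dots,N\}$ and maximum degree $\Delta\ge2$, procedure Mis_SWD always terminates within $C\log^8N\cdot\log\Delta$ rounds, and with probability at least $1-(\log\Delta)/n^2$ the set of leaders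 at termination is a maximal independent set of the communication graph. -/

import Mathlib

noncomputable section

namespace MisSWD

/-! ### The wireless model: uniform power, weak sensitivity, weak connectivity -/

/-- Parameters of the SINR model with uniform power. The sensitivity and the connectivity
parameters coincide (weak connectivity); `ε` is their common value. -/
structure SINRModel where
  /-- path loss -/
  α : ℝ
  /-- ambient noise -/
  noise : ℝ
  /-- SINR threshold -/
  β : ℝ
  /-- sensitivity and connectivity parameter -/
  ε : ℝ
  /-- common transmission power -/
  P : ℝ
  two_lt_α : 2 < α
  noise_pos : 0 < noise
  one_le_β : 1 ≤ β
  ε_pos : 0 < ε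
  ε_lt_one : ε < 1
  P_pos : 0 < P

/-- The largest distance at which a lone transmission meets the SINR threshold. -/
def SINRModel.range (M : SINRModel) : ℝ := (M.P / (M.noise * M.β)) ^ (1 / M.α)

/-- A network of `n` nodes with distinct names in `[1, N]`, placed at distinct points of the
Euclidean plane. -/
structure Network (N n : ℕ) where
  name : Fin n → ℕ
  name_mem : ∀ v, name v ∈ Finset.Icc 1 N
  name_injective : Function.Injective name
  pos : Fin n → EuclideanSpace ℝ (Fin 2)
  pos_injective : Function.Injective pos

variable {N n : ℕ}

/-- The signal-to-interference-plus-noise ratio of transmitter `v` at receiver `u` when the set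
of transmitters is `T`. -/
def sinr (M : SINRModel) (W : Network N n) (v u : Fin n) (T : Finset (Fin n)) : ℝ :=
  (M.P * dist (W.pos v) (W.pos u) ^ (-M.α)) /
    (M.noise + ∑ w ∈ T.erase v, M.P * dist (W.pos w) (W.pos u) ^ (-M.α))

/-- Successful reception in the weak-sensitivity model: `u` is not transmitting and receives the
message of `v`, when exactly the nodes of `T` transmit. -/
def Receives (M : SINRModel) (W : Network N n) (v u : Fin n) (T : Finset (Fin n)) : Prop :=
  v ∈ T ∧ u ∉ T ∧ M.β ≤ sinr M W v u T ∧ dist (W.pos v) (W.pos u) ≤ (1 - M.ε) * M.range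

/-- The communication graph. -/
def commGraph (M : SINRModel) (W : Network N n) : SimpleGraph (Fin n) where
  Adj u v := u ≠ v ∧ dist (W.pos u) (W.pos v) ≤ (1 - M.ε) * M.range
  symm := ⟨fun u v h => ⟨h.1.symm, by rw [dist_comm]; exact h.2⟩⟩
  loopless := ⟨fun _ h => h.1 rfl⟩

open Classical in
/-- The maximum degree of the communication graph. -/
def maxDeg (M : SINRModel) (W : Network N n) : ℕ := (commGraph M W).maxDegree

/-! ### Strongly selective families -/

/-- `S` is an `(N, x)`-strongly-selective family of subsets of `[1, N]`; its length is
`S.length`. -/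
def IsSSF (N x : ℕ) (S : List (Finset ℕ)) : Prop :=
  (∀ B ∈ S, B ⊆ Finset.Icc 1 N) ∧
    ∀ Z : Finset ℕ, Z ⊆ Finset.Icc 1 N → Z.Nonempty → Z.card ≤ x →
      ∀ z ∈ Z, ∃ B ∈ S, B ∩ Z = {z}

/-! ### Local memory of a node and its local steps -/

inductive Status where
  | worker
  | candidate
  | leader
  | slave
  deriving DecidableEq

/-- What a node remembers. `heard` holds the names received in the current stage, `fresh` tells
whether the node became a leader in Stage 1 of the current sub-phase, `master` is the name of the
leader chosen by a slave. -/
structure Memory where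
  status : Status
  heard : Finset ℕ
  fresh : Bool
  master : Option ℕ

/-- All nodes start as workers. -/
def Memory.init : Memory := ⟨.worker, ∅, false, none⟩

/-- Start of Stage 1: a worker whose coin shows `true` becomes a candidate. -/
def Memory.beginStage1 (coin : Bool) (m : Memory) : Memory :=
  { m with
    status := if m.status = .worker ∧ coin = true then .candidate else m.status
    heard := ∅ }

/-- End of Stage 1: a candidate that heard no other candidate becomes a leader; any other
candidate becomes a worker again. Nothing has been heard yet in Stage 2. -/
def Memory.endStage1 (m : Memory) : Memory :=
  { m with
    status :=
      if m.status = .candidate then (if m.heard = ∅ then .leader else .worker) else m.status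
    fresh := decide (m.status = .candidate ∧ m.heard = ∅)
    heard := ∅ }

/-- End of Stage 2: a worker that heard at least one name becomes a slave, and its master is the
leader with the smallest name heard. -/
def Memory.endStage2 (m : Memory) : Memory :=
  if h : m.status = .worker ∧ m.heard.Nonempty then
    { m with status := .slave, master := some (m.heard.min' h.2), fresh := false }
  else { m with fresh := false }

/-! ### Communication rounds -/

/-- Global configuration: the memories of all the nodes, and the number of communication rounds
that have elapsed. -/
structure Config (n : ℕ) where
  mem : Fin n → Memory
  rounds : ℕ

/-- Every node performs a local step; this takes no communication round. -/
def Config.localStep (f : Fin n → Memory → Memory) (c : Config n) : Config n :=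
  { c with mem := fun v => f v (c.mem v) }

open Classical in
/-- One round: the active nodes whose names lie in `B` transmit their names, and every node
records the names that it successfully receives. -/
def radioRound (M : SINRModel) (W : Network N n) (active : Memory → Bool)
    (c : Config n) (B : Finset ℕ) : Config n :=
  let T : Finset (Fin n) :=
    Finset.univ.filter fun v => active (c.mem v) = true ∧ W.name v ∈ B
  { mem := fun u =>
      { c.mem u with
        heard := (c.mem u).heard ∪
          (Finset.univ.filter fun v => Receives M W v u T).image W.name }
    rounds := c.rounds + 1 }

/-- The active nodes execute the family `S`, one set per round. -/
def executeFamily (M : SINRModel) (W : Network N n) (S : List (Finset ℕ))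
    (active : Memory → Bool) (c : Config n) : Config n :=
  S.foldl (radioRound M W active) c

/-! ### The procedure -/

/-- A sub-phase, with the outcomes of the nodes' coins given. In Stage 1 the candidates execute
the family, in Stage 2 the leaders elected in Stage 1 do. -/
def subPhaseWith (M : SINRModel) (W : Network N n) (S : List (Finset ℕ))
    (c : Config n) (coin : Fin n → Bool) : Config n :=
  let c₁ := c.localStep fun v => Memory.beginStage1 (coin v)
  let c₂ := executeFamily M W S (fun m => decide (m.status = .candidate)) c₁
  let c₃ := c₂.localStep fun _ => Memory.endStage1
  let c₄ := executeFamily M W S (fun m => m.fresh) c₃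
  c₄.localStep fun _ => Memory.endStage2

open scoped ENNReal in
/-- Independent coins, one per node, each showing `true` with probability `p`. -/
def coins (n : ℕ) (p : ℝ≥0∞) (hp : p ≤ 1) : PMF (Fin n → Bool) :=
  PMF.ofFintype (fun x => ∏ v, if x v = true then p else 1 - p) <| by
    have h := Finset.prod_univ_sum (fun _ : Fin n => (Finset.univ : Finset Bool))
      (fun _ b => if b = true then p else 1 - p)
    rw [Fintype.piFinset_univ] at h
    rw [← h]
    simp [add_tsub_cancel_of_le hp]

/-- `m` consecutive runs of a randomized step, with fresh independent randomness in each run. -/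
def repeatStep {σ : Type} (f : σ → PMF σ) : ℕ → σ → PMF σ
  | 0, c => PMF.pure c
  | m + 1, c => (f c).bind (repeatStep f m)

/-- The candidate probability `2 ^ i / 2 ^ k`, for `i ≤ k`, is a probability. -/
theorem phaseProb_le_one {k : ℕ} (i : Fin (k + 1)) :
    ((2 : ENNReal) ^ (i : ℕ) / 2 ^ k) ≤ 1 :=
  ENNReal.div_le_of_le_mul
    (by rw [one_mul]; exact pow_le_pow_right₀ (by norm_num) (Nat.lt_succ_iff.mp i.isLt))

/-- Phase `i` (where `0 ≤ i ≤ k`): `m` sub-phases with candidate probability `2 ^ i / 2 ^ k`. -/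
def phase (M : SINRModel) (W : Network N n) (S : List (Finset ℕ)) (m k : ℕ)
    (c : Config n) (i : Fin (k + 1)) : PMF (Config n) :=
  repeatStep
    (fun c => (coins n (2 ^ (i : ℕ) / 2 ^ k) (phaseProb_le_one i)).map (subPhaseWith M W S c)) m c

/-- The procedure `Mis_SWD` from a synchronized start, as the probability distribution of its
final configuration, for a known maximum degree `Δ`, the family `S`, and `m` sub-phases per phase.
The number `Δ` is rounded up to the power of two `2 ^ k` with `k = Nat.clog 2 Δ`. -/
def misSWD (M : SINRModel) (W : Network N n) (S : List (Finset ℕ)) (m Δ : ℕ) : PMF (Config n) :=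
  (List.finRange (Nat.clog 2 Δ + 1)).foldlM (phase M W S m (Nat.clog 2 Δ))
    ⟨fun _ => Memory.init, 0⟩

/-- The set of leaders of a configuration. -/
def leaders (c : Config n) : Set (Fin n) := {v | (c.mem v).status = .leader}

/-- The leaders form a maximal independent set of the communication graph. -/
def LeadersFormMIS (M : SINRModel) (W : Network N n) (c : Config n) : Prop :=
  Maximal (commGraph M W).IsIndepSet (leaders c)

end MisSWD

end

noncomputable section

namespace MisSWD

/-! ### Hitting sets and strongly selective families -/

/-! Two facts carry the proof: the family acts as a reliable local broadcast for sparse sets of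
transmitters, and, given such broadcasts, each phase before the last halves the bound on the degrees
among the workers.

Local broadcast (`exists_local_broadcast`). Suppose at most `g` active nodes lie within the range of
communication of each active node. Comparison with a square grid bounds the total weight of the
active nodes, seen from a receiver `u`, by a constant times `g`; this uses `α > 2`. Call a set of
the family heavy if the transmitters other than `v` weigh more than a threshold. Each heavy set
carries a fraction of order `1 / g` of the total weight, so a greedy choice yields `O(g log |S|)`
nodes that meet all heavy sets. Selectivity, applied to `v` and these nodes, gives a round in which
`v` transmits and none of them does. That round is not heavy, and its interference fits into the
slack left by the factor `1 - ε`, so `u` hears `v`. For `g = O(log N)` the selected set has at most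
`b log³ N` elements; `exists_large_constant` settles the dependence of `|S|` on `b`. Families of the
required length come from colourings, chosen by the same greedy lemma.

Degrees. At the start of phase `i < k` every worker has at most `D = 2 ^ (k - i)` adjacent workers,
and the candidate probability is `1 / D`. About a worker at most 2 candidates are expected, so by an
exponential moment the candidates have density `O(log N)` with high probability. Then exactly the
isolated candidates become leaders and their worker neighbours become slaves
(`subPhaseWith_status`). A worker with at least `D / 2` adjacent workers drops out with probability
at least 1/32 (`le_coins_coveringCoins`), so the expected number of such workers decays
geometrically (`repeatStep_drift`), and `O(log N)` sub-phases are likely to remove them all. Before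
phase `k` no two workers are adjacent; there all workers are candidates and become leaders. Without
workers, the invariant `Consistent` says that the leaders form a maximal independent set. The errors
of the phases add up. -/

open Classical in
/-- Greedy choice: if every member of a finite family of sets carries at least a fraction `q` of
the total weight, then `t` points leave at most a fraction `(1 - q) ^ t` of the family unhit. -/
theorem exists_greedy_hitting {Y I : Type*} (A : Finset Y) (w : Y → ℝ)
    (hw : ∀ y ∈ A, 0 ≤ w y) (hW : 0 < ∑ y ∈ A, w y) (R : I → Y → Prop) (J : Finset I) {q : ℝ}
    (hq : q ≤ 1) (h : ∀ i ∈ J, q * ∑ y ∈ A, w y ≤ ∑ y ∈ A with R i y, w y) (t : ℕ) :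
    ∃ H ⊆ A, H.card ≤ t ∧
      ((J.filter fun i => ∀ y ∈ H, ¬ R i y).card : ℝ) ≤ (1 - q) ^ t * J.card := by
  induction t with
  | zero => exact ⟨∅, by simp, by simp, by simp⟩
  | succ t ih =>
    obtain ⟨H, hHA, hHt, hH⟩ := ih
    set J' := J.filter fun i => ∀ y ∈ H, ¬ R i y with hJ'
    -- Averaging: a point drawn with probability proportional to `w` hits each member of `J'` with
    -- probability at least `q`, so some point hits a fraction `q` of `J'`.
    obtain ⟨y, hyA, hy⟩ : ∃ y ∈ A, q * J'.card ≤ ((J'.filter fun i => R i y).card : ℝ) := by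
      by_contra! hcon
      obtain ⟨y₀, hy₀, hpos⟩ : ∃ y ∈ A, 0 < w y := by
        by_contra! hle
        exact absurd (Finset.sum_nonpos hle) (not_le.mpr hW)
      have h1 : ∑ y ∈ A, w y * ((J'.filter fun i => R i y).card : ℝ)
          < ∑ y ∈ A, w y * (q * J'.card) :=
        Finset.sum_lt_sum
          (fun y hy => mul_le_mul_of_nonneg_left (hcon y hy).le (hw y hy))
          ⟨y₀, hy₀, mul_lt_mul_of_pos_left (hcon y₀ hy₀) hpos⟩
      have h2 : ∑ y ∈ A, w y * ((J'.filter fun i => R i y).card : ℝ)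
          = ∑ i ∈ J', ∑ y ∈ A with R i y, w y := by
        simp only [Finset.card_filter, Nat.cast_sum, Finset.mul_sum, Finset.sum_filter]
        rw [Finset.sum_comm]
        refine Finset.sum_congr rfl fun i _ => Finset.sum_congr rfl fun y _ => ?_
        split_ifs <;> simp
      have h3 : ∑ i ∈ J', q * ∑ y ∈ A, w y ≤ ∑ i ∈ J', ∑ y ∈ A with R i y, w y :=
        Finset.sum_le_sum fun i hi => h i (Finset.mem_filter.mp hi).1
      rw [← Finset.sum_mul, Finset.sum_const, nsmul_eq_mul] at *
      rw [h2] at h1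
      nlinarith
    refine ⟨insert y H, Finset.insert_subset hyA hHA,
      (Finset.card_insert_le _ _).trans (by omega), ?_⟩
    have h4 : (J.filter fun i => ∀ z ∈ insert y H, ¬ R i z) = J'.filter fun i => ¬ R i y := by
      ext i
      simp only [hJ', Finset.mem_filter, Finset.mem_insert, forall_eq_or_imp]
      tauto
    have h5 : ((J'.filter fun i => R i y).card : ℝ) + (J'.filter fun i => ¬ R i y).card
        = J'.card := by
      exact_mod_cast Finset.card_filter_add_card_filter_not (s := J') (fun i => R i y)
    rw [h4, pow_succ]
    have h6 : (1 - q) * (J'.card : ℝ) ≤ (1 - q) * ((1 - q) ^ t * J.card) :=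
      mul_le_mul_of_nonneg_left hH (by linarith)
    nlinarith

open Classical in
/-- A family of sets, each of which carries at least a fraction `q` of the total weight, has a
hitting set of size `t` as soon as `(1 - q) ^ t` is less than the inverse of its size. -/
theorem exists_hitting_set {Y I : Type*} (A : Finset Y) (w : Y → ℝ)
    (hw : ∀ y ∈ A, 0 ≤ w y) (hW : 0 < ∑ y ∈ A, w y) (R : I → Y → Prop) (J : Finset I) {q : ℝ}
    (hq : q ≤ 1)
    (h : ∀ i ∈ J, q * ∑ y ∈ A, w y ≤ ∑ y ∈ A with R i y, w y)
    (t : ℕ) (ht : (1 - q) ^ t * J.card < 1) :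
    ∃ H ⊆ A, H.card ≤ t ∧ ∀ i ∈ J, ∃ y ∈ H, R i y := by
  obtain ⟨H, hHA, hHt, hH⟩ := exists_greedy_hitting A w hw hW R J hq h t
  refine ⟨H, hHA, hHt, fun i hi => ?_⟩
  by_contra! hcon
  have h0 : 0 < (J.filter fun i => ∀ y ∈ H, ¬ R i y).card :=
    Finset.card_pos.mpr ⟨i, Finset.mem_filter.mpr ⟨hi, hcon⟩⟩
  have h1 : (1 : ℝ) ≤ ((J.filter fun i => ∀ y ∈ H, ¬ R i y).card : ℝ) := by exact_mod_cast h0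
  linarith

open Classical in
/-- A `1 / q` fraction of the colourings with `q` colours identifies two given points. -/
theorem card_colourings_collide {X : Type*} [Fintype X] (q : ℕ) {y z : X} (hyz : y ≠ z) :
    (Finset.univ.filter fun f : X → Fin q => f y = f z).card * q ≤ Fintype.card (X → Fin q) := by
  calc _ = ((Finset.univ.filter fun f : X → Fin q => f y = f z) ×ˢ
        (Finset.univ : Finset (Fin q))).card := by simp
    _ ≤ (Finset.univ : Finset (X → Fin q)).card := by
        -- Recolouring `y` arbitrarily loses nothing: the old colour of `y` is that of `z`, which is
        -- unchanged.
        refine Finset.card_le_card_of_injOn (fun p => Function.update p.1 y p.2)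
          (fun _ _ => Finset.mem_coe.mpr (Finset.mem_univ _)) ?_
        rintro ⟨f, c⟩ hf ⟨g, d⟩ hg hfg
        simp only [Finset.coe_product, Set.mem_prod, Finset.mem_coe, Finset.mem_filter,
          Finset.mem_univ, true_and, and_true] at hf hg
        simp only at hfg
        have hc : c = d := by simpa using congrFun hfg y
        have hne : ∀ x, x ≠ y → f x = g x := fun x hx => by
          simpa [Function.update_of_ne hx] using congrFun hfg x
        refine Prod.ext (funext fun x => ?_) hc
        by_cases hx : x = y
        · subst hx
          exact hf.trans ((hne _ hyz.symm).trans hg.symm)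
        · exact hne x hx
    _ = _ := by simp

open Classical in
/-- For `x` points and `2 * x` colours, at least half of the colourings separate a given point
from all of the points. -/
theorem half_le_card_separating {X : Type*} [Fintype X] {x : ℕ} (hx : 0 < x) (z : X)
    (y : Fin x → X) :
    Fintype.card (X → Fin (2 * x)) ≤
      2 * (Finset.univ.filter fun f : X → Fin (2 * x) =>
        ∀ j, y j ≠ z → f (y j) ≠ f z).card := by
  set G : Finset (X → Fin (2 * x)) := Finset.univ.filter fun f => ∀ j, y j ≠ z → f (y j) ≠ f z
    with hG
  have hsub : Gᶜ ⊆ (Finset.univ.filter fun j => y j ≠ z).biUnion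
      fun j => Finset.univ.filter fun f : X → Fin (2 * x) => f (y j) = f z := by
    intro f hf
    simp only [hG, Finset.mem_compl, Finset.mem_filter, Finset.mem_univ, true_and, not_forall,
      not_not, exists_prop] at hf
    obtain ⟨j, h1, h2⟩ := hf
    simp only [Finset.mem_biUnion, Finset.mem_filter, Finset.mem_univ, true_and]
    exact ⟨j, h1, h2⟩
  -- Union bound: each of the `x` points collides with `z` for a fraction `1 / (2 * x)` of the
  -- colourings.
  have hbad : Gᶜ.card * (2 * x) ≤ x * Fintype.card (X → Fin (2 * x)) := by
    calc _ ≤ (∑ j ∈ Finset.univ.filter (fun j => y j ≠ z),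
          (Finset.univ.filter fun f : X → Fin (2 * x) => f (y j) = f z).card) * (2 * x) :=
          Nat.mul_le_mul_right _ ((Finset.card_le_card hsub).trans Finset.card_biUnion_le)
      _ ≤ ∑ j ∈ Finset.univ.filter (fun j : Fin x => y j ≠ z),
            Fintype.card (X → Fin (2 * x)) := by
          rw [Finset.sum_mul]
          exact Finset.sum_le_sum fun j hj =>
            card_colourings_collide (2 * x) (Finset.mem_filter.mp hj).2
      _ ≤ x * Fintype.card (X → Fin (2 * x)) := by
          rw [Finset.sum_const, smul_eq_mul]
          exact Nat.mul_le_mul_right _ ((Finset.card_filter_le _ _).trans (by simp))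
  have hbad' : 2 * Gᶜ.card ≤ Fintype.card (X → Fin (2 * x)) := by
    refine Nat.le_of_mul_le_mul_left ?_ hx
    calc _ = Gᶜ.card * (2 * x) := by ring
      _ ≤ _ := hbad
  have := Finset.card_add_card_compl G
  omega

open Classical in
/-- There are `t` colourings with `2 * x` colours such that every point is separated from any `x`
points by one of them, provided that `2 ^ t` exceeds the number of choices of these points. -/
theorem exists_separating_colourings {X : Type*} [Fintype X] {x t : ℕ} (hx : 0 < x)
    (ht : Fintype.card X ^ (x + 1) < 2 ^ t) :
    ∃ H : Finset (X → Fin (2 * x)), H.card ≤ t ∧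
      ∀ (z : X) (y : Fin x → X), ∃ f ∈ H, ∀ j, y j ≠ z → f (y j) ≠ f z := by
  have : NeZero (2 * x) := ⟨by omega⟩
  have hcount : ∀ i ∈ (Finset.univ : Finset (X × (Fin x → X))),
      (1 / 2 : ℝ) * ∑ _f ∈ (Finset.univ : Finset (X → Fin (2 * x))), (1 : ℝ) ≤
        ∑ _f ∈ Finset.univ.filter fun f : X → Fin (2 * x) =>
          ∀ j, i.2 j ≠ i.1 → f (i.2 j) ≠ f i.1, (1 : ℝ) := by
    rintro ⟨z, y⟩ -
    have h1 : (Fintype.card (X → Fin (2 * x)) : ℝ) ≤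
        2 * ((Finset.univ.filter fun f : X → Fin (2 * x) =>
          ∀ j, y j ≠ z → f (y j) ≠ f z).card : ℝ) := by
      exact_mod_cast half_le_card_separating hx z y
    simp only [Finset.sum_const, nsmul_eq_mul, mul_one, Finset.card_univ]
    linarith
  have hsize : (1 - 1 / 2 : ℝ) ^ t * (Finset.univ : Finset (X × (Fin x → X))).card < 1 := by
    have h1 : (Finset.univ : Finset (X × (Fin x → X))).card = Fintype.card X ^ (x + 1) := by
      rw [Finset.card_univ, Fintype.card_prod, Fintype.card_fun, Fintype.card_fin]
      ring
    rw [h1, show (1 - 1 / 2 : ℝ) = 2⁻¹ by norm_num, inv_pow, inv_mul_lt_one₀ (by positivity)]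
    exact_mod_cast ht
  obtain ⟨H, -, hHt, hH⟩ := exists_hitting_set (Finset.univ : Finset (X → Fin (2 * x)))
    (fun _ => 1) (fun _ _ => by norm_num)
    (by
      simp only [Finset.sum_const, nsmul_eq_mul, mul_one]
      exact_mod_cast Finset.card_pos.mpr ⟨fun _ => 0, Finset.mem_univ _⟩)
    (fun (i : X × (Fin x → X)) f => ∀ j, i.2 j ≠ i.1 → f (i.2 j) ≠ f i.1) Finset.univ
    (q := 1 / 2) (by norm_num) (fun i hi => by convert hcount i hi) t hsize
  exact ⟨H, hHt, fun z y => hH (z, y) (Finset.mem_univ _)⟩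

open Classical in
/-- Strongly selective families of length `O (x² log N)` exist. -/
theorem exists_isSSF (N x : ℕ) (hx : 0 < x) :
    ∃ S : List (Finset ℕ), IsSSF N x S ∧
      S.length ≤ ((x + 1) * Nat.clog 2 N + 1) * (2 * x) := by
  have hcardX : Fintype.card (Finset.Icc 1 N) = N := by simp
  -- There are `N ^ (x + 1)` choices of a point and `x` further points; the final `+ 1` in the
  -- exponent makes the inequality strict.
  have h2 : N ^ (x + 1) < 2 ^ ((x + 1) * Nat.clog 2 N + 1) := by
    calc N ^ (x + 1) ≤ (2 ^ Nat.clog 2 N) ^ (x + 1) :=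
          Nat.pow_le_pow_left (Nat.le_pow_clog (by norm_num) N) _
      _ = 2 ^ ((x + 1) * Nat.clog 2 N) := by rw [← pow_mul, mul_comm]
      _ < _ := Nat.pow_lt_pow_right (by norm_num) (by omega)
  obtain ⟨H, hHt, hH⟩ := exists_separating_colourings (X := Finset.Icc 1 N) hx
    (by rwa [hcardX])
  -- The family consists of all colour classes of the chosen colourings, `2 * x` for each of them.
  let cls : (Finset.Icc 1 N → Fin (2 * x)) × Fin (2 * x) → Finset ℕ := fun p =>
    (Finset.univ.filter fun m : Finset.Icc 1 N => p.1 m = p.2).image Subtype.val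
  refine ⟨(H ×ˢ Finset.univ).toList.map cls, ⟨?_, ?_⟩, ?_⟩
  · intro B hB
    obtain ⟨p, -, rfl⟩ := List.mem_map.mp hB
    intro m hm
    obtain ⟨m', -, rfl⟩ := Finset.mem_image.mp hm
    exact m'.2
  · intro Z hZ _ hZx z hz
    let z' : Finset.Icc 1 N := ⟨z, hZ hz⟩
    let e := Z.equivFin.symm
    -- An enumeration of `Z`, padded with `z'` to length `x`; separation ignores entries equal to
    -- `z'`.
    let y : Fin x → Finset.Icc 1 N := fun j =>
      if hj : (j : ℕ) < Z.card then ⟨e ⟨j, hj⟩, hZ (e ⟨j, hj⟩).2⟩ else z'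
    have hy : ∀ m (hm : m ∈ Z), ∃ j, y j = ⟨m, hZ hm⟩ := by
      intro m hm
      have hlt := (Z.equivFin ⟨m, hm⟩).2
      refine ⟨⟨Z.equivFin ⟨m, hm⟩, hlt.trans_le hZx⟩, ?_⟩
      simp [y, e]
    obtain ⟨f, hf, hfR⟩ := hH z' y
    refine ⟨cls (f, f z'), List.mem_map.mpr ⟨(f, f z'), by simp [hf], rfl⟩, ?_⟩
    ext m
    simp only [cls, Finset.mem_inter, Finset.mem_image, Finset.mem_filter, Finset.mem_univ,
      true_and, Finset.mem_singleton]
    constructor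
    · rintro ⟨⟨m', hm', rfl⟩, hm⟩
      by_contra hne
      obtain ⟨j, hj⟩ := hy _ hm
      refine hfR j ?_ ?_
      · rw [hj]
        exact fun h => hne (congrArg Subtype.val h)
      · rw [hj]
        exact hm'
    · rintro rfl
      exact ⟨⟨z', rfl, rfl⟩, hz⟩
  · simp only [List.length_map, Finset.length_toList, Finset.card_product, Finset.card_univ,
      Fintype.card_fin]
    exact Nat.mul_le_mul_right _ hHt

/-! ### Interference in the plane -/

/-- The cell of the square grid of side `ℓ` that contains `x`. -/
def gridCell (ℓ : ℝ) (x : EuclideanSpace ℝ (Fin 2)) : Fin 2 → ℤ := fun i => ⌊x i / ℓ⌋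

theorem dist_le_of_gridCell_eq {ℓ : ℝ} (hℓ : 0 < ℓ) {x y : EuclideanSpace ℝ (Fin 2)}
    (h : gridCell ℓ x = gridCell ℓ y) : dist x y ≤ 2 * ℓ := by
  have hi : ∀ i, (x i - y i) ^ 2 ≤ ℓ ^ 2 := fun i => by
    have h1 := Int.abs_sub_lt_one_of_floor_eq_floor (congrFun h i)
    rw [← sub_div, abs_div, abs_of_pos hℓ, div_lt_one hℓ] at h1
    exact sq_le_sq' (by linarith [neg_abs_le (x i - y i)]) (by linarith [le_abs_self (x i - y i)])
  rw [EuclideanSpace.dist_eq, Fin.sum_univ_two, Real.dist_eq, Real.dist_eq, sq_abs, sq_abs]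
  exact Real.sqrt_le_iff.mpr ⟨by positivity, by nlinarith [hi 0, hi 1]⟩

/-- The norm of a cell is the maximum norm on integer vectors; rounding down costs at most 1. -/
theorem norm_gridCell_le {ℓ : ℝ} (hℓ : 0 < ℓ) (x : EuclideanSpace ℝ (Fin 2)) :
    ‖gridCell ℓ x‖ ≤ ‖x‖ / ℓ + 1 := by
  refine (pi_norm_le_iff_of_nonneg (by positivity)).mpr fun i => ?_
  have h1 : |x i / ℓ| ≤ ‖x‖ / ℓ := by
    rw [abs_div, abs_of_pos hℓ]
    exact div_le_div_of_nonneg_right (by simpa using PiLp.norm_apply_le x i) hℓ.le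
  have h2 := Int.floor_le (x i / ℓ)
  have h3 := Int.lt_floor_add_one (x i / ℓ)
  rw [Int.norm_eq_abs, abs_le]
  simp only [gridCell]
  constructor <;> linarith [abs_le.mp h1]

/-- The weight of a grid cell: up to a constant factor, the power received from a node in this
cell by a node at the origin. -/
def cellWeight (α : ℝ) (q : Fin 2 → ℤ) : ℝ := (1 + ‖q‖) ^ (-α)

theorem cellWeight_pos (α : ℝ) (q : Fin 2 → ℤ) : 0 < cellWeight α q :=
  Real.rpow_pos_of_pos (by positivity) _

/-- Comparison with the lattice sum of `‖q‖ ^ (-α)` over the plane, which needs `α > 2`. The cell 0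
is left out, since `0 ^ (-α)` is 0 by convention. -/
theorem summable_cellWeight {α : ℝ} (hα : 2 < α) : Summable (cellWeight α) := by
  refine (EisensteinSeries.summable_one_div_norm_rpow hα).of_norm_bounded_eventually ?_
  have h : ∀ q : Fin 2 → ℤ, q ≠ 0 → ‖cellWeight α q‖ ≤ ‖q‖ ^ (-α) := fun q hq => by
    rw [Real.norm_of_nonneg (cellWeight_pos α q).le]
    exact Real.rpow_le_rpow_of_nonpos (norm_pos_iff.mpr hq) (by linarith) (by linarith)
  refine (Set.finite_singleton (0 : Fin 2 → ℤ)).subset fun q hq => ?_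
  by_contra hne
  exact hq (h q hne)

theorem one_le_tsum_cellWeight {α : ℝ} (hα : 2 < α) : 1 ≤ ∑' q, cellWeight α q := by
  have h := (summable_cellWeight hα).le_tsum 0 fun q _ => (cellWeight_pos α q).le
  simpa [cellWeight] using h

/-- If at most `g` points lie within distance `2 * ℓ` of each point, then the total weight of the
cells of the points is at most `g` times a constant. -/
theorem sum_cellWeight_le {ι : Type*} {α ℓ : ℝ} (hα : 2 < α) (hℓ : 0 < ℓ)
    (f : ι → EuclideanSpace ℝ (Fin 2)) (o : EuclideanSpace ℝ (Fin 2)) (X : Finset ι) (g : ℕ)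
    (hg : ∀ v ∈ X, (X.filter fun w => dist (f v) (f w) ≤ 2 * ℓ).card ≤ g) :
    ∑ w ∈ X, cellWeight α (gridCell ℓ (f w - o)) ≤ g * ∑' q, cellWeight α q := by
  rw [Finset.sum_comp (cellWeight α) (fun w => gridCell ℓ (f w - o))]
  calc _ ≤ ∑ q ∈ X.image (fun w => gridCell ℓ (f w - o)), (g : ℝ) * cellWeight α q := by
        refine Finset.sum_le_sum fun q hq => ?_
        rw [nsmul_eq_mul]
        refine mul_le_mul_of_nonneg_right ?_ (cellWeight_pos α q).le
        obtain ⟨v, hv, rfl⟩ := Finset.mem_image.mp hq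
        refine Nat.cast_le.mpr ((Finset.card_le_card fun w hw => ?_).trans (hg v hv))
        rw [Finset.mem_filter] at hw ⊢
        refine ⟨hw.1, ?_⟩
        simpa using dist_le_of_gridCell_eq hℓ hw.2.symm
    _ ≤ _ := by
        rw [← Finset.mul_sum]
        exact mul_le_mul_of_nonneg_left ((summable_cellWeight hα).sum_le_tsum _
          fun q _ => (cellWeight_pos α q).le) (Nat.cast_nonneg g)

/-- A point whose cell has small weight is far from the origin. -/
theorem rpow_norm_le_cellWeight {α ℓ : ℝ} (hα : 0 < α) (hℓ : 0 < ℓ)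
    (x : EuclideanSpace ℝ (Fin 2)) (hx : cellWeight α (gridCell ℓ x) < 4 ^ (-α)) :
    ‖x‖ ^ (-α) ≤ (ℓ / 2) ^ (-α) * cellWeight α (gridCell ℓ x) := by
  -- From 3 on, `‖q‖ - 1 ≥ (1 + ‖q‖) / 2`, so the rounding loss only costs a factor 2 in the
  -- distance.
  have h3 : 3 ≤ ‖gridCell ℓ x‖ := by
    by_contra! h
    refine absurd hx (not_lt.mpr ?_)
    exact Real.rpow_le_rpow_of_nonpos (by positivity) (by linarith) (by linarith)
  have h1 : ‖gridCell ℓ x‖ - 1 ≤ ‖x‖ / ℓ := by linarith [norm_gridCell_le hℓ x]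
  rw [le_div_iff₀ hℓ] at h1
  rw [cellWeight, ← Real.mul_rpow (by positivity) (by positivity)]
  exact Real.rpow_le_rpow_of_nonpos (by positivity) (by nlinarith) (by linarith)

/-! ### Local broadcast by a strongly selective family -/

/-- The range of communication. -/
def SINRModel.reach (M : SINRModel) : ℝ := (1 - M.ε) * M.range

theorem SINRModel.range_pos (M : SINRModel) : 0 < M.range :=
  Real.rpow_pos_of_pos (div_pos M.P_pos (mul_pos M.noise_pos (by linarith [M.one_le_β]))) _

theorem SINRModel.reach_pos (M : SINRModel) : 0 < M.reach :=
  mul_pos (by linarith [M.ε_lt_one]) M.range_pos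

/-- The interference that does not prevent reception within the range of communication. -/
def SINRModel.slack (M : SINRModel) : ℝ := M.noise * ((1 - M.ε) ^ (-M.α) - 1)

theorem SINRModel.slack_pos (M : SINRModel) : 0 < M.slack := by
  refine mul_pos M.noise_pos (sub_pos.mpr ?_)
  exact Real.one_lt_rpow_of_pos_of_lt_one_of_neg (by linarith [M.ε_lt_one])
    (by linarith [M.ε_pos]) (by linarith [M.two_lt_α])

/-- The range is defined by `P * range ^ (-α) = noise * β`. Shrinking the distance by `1 - ε`
multiplies the power by `(1 - ε) ^ (-α)`, and `slack` is the gain in units of tolerable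
interference. -/
theorem SINRModel.mul_rpow_reach (M : SINRModel) :
    M.P * M.reach ^ (-M.α) = M.β * (M.noise + M.slack) := by
  have hα : M.α ≠ 0 := by linarith [M.two_lt_α]
  have hβ : 0 < M.β := by linarith [M.one_le_β]
  have h0 : 0 ≤ M.P / (M.noise * M.β) := (div_pos M.P_pos (mul_pos M.noise_pos hβ)).le
  have h1 : M.range ^ (-M.α) = M.noise * M.β / M.P := by
    rw [SINRModel.range, ← Real.rpow_mul h0, one_div, mul_neg, inv_mul_cancel₀ hα,
      Real.rpow_neg_one, inv_div]
  rw [SINRModel.reach, Real.mul_rpow (by linarith [M.ε_lt_one]) M.range_pos.le, h1,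
    SINRModel.slack]
  field_simp [M.P_pos.ne']
  ring

/-- A transmission within the range of communication is received if the interference is
small. -/
theorem receives_of_interference_le (M : SINRModel) {N n : ℕ} (W : Network N n) {u v : Fin n}
    (huv : u ≠ v) {T : Finset (Fin n)} (hv : v ∈ T) (hu : u ∉ T)
    (hd : dist (W.pos v) (W.pos u) ≤ M.reach)
    (hI : ∑ w ∈ T.erase v, M.P * dist (W.pos w) (W.pos u) ^ (-M.α) ≤ M.slack) :
    Receives M W v u T := by
  refine ⟨hv, hu, ?_, hd⟩
  have hd0 : 0 < dist (W.pos v) (W.pos u) :=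
    dist_pos.mpr fun h => huv (W.pos_injective h).symm
  have hI0 : 0 ≤ ∑ w ∈ T.erase v, M.P * dist (W.pos w) (W.pos u) ^ (-M.α) :=
    Finset.sum_nonneg fun w _ => mul_nonneg M.P_pos.le (Real.rpow_nonneg dist_nonneg _)
  rw [sinr, le_div_iff₀ (by linarith [M.noise_pos])]
  calc M.β * (M.noise + ∑ w ∈ T.erase v, M.P * dist (W.pos w) (W.pos u) ^ (-M.α))
      ≤ M.β * (M.noise + M.slack) := by
        have := M.one_le_β
        gcongr
    _ = M.P * M.reach ^ (-M.α) := M.mul_rpow_reach.symm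
    _ ≤ _ := mul_le_mul_of_nonneg_left
        (Real.rpow_le_rpow_of_nonpos hd0 hd (by linarith [M.two_lt_α])) M.P_pos.le

/-- The bound `4 ^ (-α)` keeps every transmitter of a light round far enough for
`rpow_norm_le_cellWeight`; the last bound keeps the total interference within the slack. The grid
has side `reach / 2`. -/
theorem exists_weight_threshold (M : SINRModel) :
    ∃ τ : ℝ, 0 < τ ∧ τ < 4 ^ (-M.α) ∧ M.P * (M.reach / 2 / 2) ^ (-M.α) * τ ≤ M.slack := by
  have hR : 0 < M.reach / 2 / 2 := by linarith [M.reach_pos]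
  have h1 : 0 < M.P * (M.reach / 2 / 2) ^ (-M.α) :=
    mul_pos M.P_pos (Real.rpow_pos_of_pos hR _)
  have h2 : (0 : ℝ) < 4 ^ (-M.α) := Real.rpow_pos_of_pos (by norm_num) _
  refine ⟨min (4 ^ (-M.α) / 2) (M.slack / (M.P * (M.reach / 2 / 2) ^ (-M.α))),
    lt_min (by linarith) (div_pos M.slack_pos h1), (min_le_left _ _).trans_lt (by linarith), ?_⟩
  rw [← le_div_iff₀' h1]
  exact min_le_right _ _

open Classical in
/-- At most `g` nodes of `X` lie within the range of communication of each node of `X`. -/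
def HasDensity (M : SINRModel) {N n : ℕ} (W : Network N n) (X : Finset (Fin n)) (g : ℕ) : Prop :=
  ∀ v ∈ X, (X.filter fun w => dist (W.pos v) (W.pos w) ≤ M.reach).card ≤ g

open Classical in
/-- When a set of nodes of density `g` executes an `(N, x)`-strongly-selective family `S`, where
`x` is of the order of `g log |S|`, every node receives the messages of all its active
neighbours. The family is applied to the transmitter and a set of nodes that meets every round of
heavy interference. -/
theorem exists_local_broadcast (M : SINRModel) :
    ∃ K : ℝ, 1 ≤ K ∧ ∀ (N n : ℕ) (W : Network N n) (X : Finset (Fin n)) (g : ℕ)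
      (S : List (Finset ℕ)) (x t : ℕ), HasDensity M W X g → IsSSF N x S → t + 1 ≤ x →
      (1 - 1 / (K * g)) ^ t * (S.length : ℝ) < 1 →
      ∀ v ∈ X, ∀ u, (commGraph M W).Adj u v →
        ∃ B ∈ S, Receives M W v u (Finset.univ.filter fun w => w ∈ X ∧ W.name w ∈ B) := by
  obtain ⟨τ, hτ0, hτ4, hτI⟩ := exists_weight_threshold M
  have hα := M.two_lt_α
  have hτ1 : τ < 1 := hτ4.trans_le
    (Real.rpow_le_one_of_one_le_of_nonpos (by norm_num) (by linarith))
  set K₀ := ∑' q, cellWeight M.α q with hK₀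
  have hK1 : 1 ≤ K₀ := one_le_tsum_cellWeight hα
  -- A heavy round has weight above `τ` out of at most `g * K₀`, hence a fraction of at least `1 /
  -- (K * g)`.
  refine ⟨K₀ / τ, (one_le_div hτ0).mpr (by linarith), ?_⟩
  intro N n W X g S x t hX hS hx ht v hv u hadj
  have hℓ : 0 < M.reach / 2 := by linarith [M.reach_pos]
  have hg1 : 1 ≤ g := (Finset.card_pos.mpr ⟨v, Finset.mem_filter.mpr
    ⟨hv, by simpa using M.reach_pos.le⟩⟩).trans_le (hX v hv)
  have hg1' : (1 : ℝ) ≤ g := by exact_mod_cast hg1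
  set ω : Fin n → ℝ := fun w => cellWeight M.α (gridCell (M.reach / 2) (W.pos w - W.pos u))
    with hω
  have hω0 : ∀ w, 0 < ω w := fun w => cellWeight_pos _ _
  set A := X.erase v with hA
  have htot : ∑ w ∈ A, ω w ≤ g * K₀ :=
    (Finset.sum_le_sum_of_subset_of_nonneg (Finset.erase_subset v X)
      fun w _ _ => (hω0 w).le).trans
      (sum_cellWeight_le hα hℓ W.pos (W.pos u) X g fun w hw => by
        simpa only [mul_div_cancel₀ M.reach two_ne_zero] using hX w hw)
  set J := S.toFinset.filter fun B => τ < ∑ w ∈ A with W.name w ∈ B, ω w with hJ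
  obtain ⟨H, hHA, hHt, hH⟩ : ∃ H ⊆ A, H.card ≤ t ∧ ∀ B ∈ J, ∃ w ∈ H, W.name w ∈ B := by
    rcases A.eq_empty_or_nonempty with h0 | h0
    · refine ⟨∅, by simp, by simp, fun B hB => ?_⟩
      have := (Finset.mem_filter.mp hB).2
      rw [h0] at this
      simp only [Finset.filter_empty, Finset.sum_empty] at this
      linarith
    · have hgK : 0 < K₀ / τ * g := by positivity
      refine exists_hitting_set A ω (fun w _ => (hω0 w).le)
        (Finset.sum_pos (fun w _ => hω0 w) h0) (fun B w => W.name w ∈ B) J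
        (q := 1 / (K₀ / τ * g)) ?_ ?_ t ?_
      · rw [div_le_one hgK]
        have : 1 ≤ K₀ / τ := (one_le_div hτ0).mpr (by linarith)
        nlinarith
      · intro B hB
        refine le_trans ?_ (le_trans (Finset.mem_filter.mp hB).2.le (le_of_eq ?_))
        · rw [div_mul_eq_mul_div, one_mul, div_le_iff₀ hgK]
          calc _ ≤ _ := htot
            _ = _ := by field_simp
        · exact Finset.sum_congr (by ext; simp) fun _ _ => rfl
      · refine lt_of_le_of_lt (mul_le_mul_of_nonneg_left ?_ ?_) ht
        · exact_mod_cast (Finset.card_filter_le _ _).trans (List.toFinset_card_le S)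
        · refine pow_nonneg (sub_nonneg.mpr ?_) t
          rw [div_le_one hgK]
          have : 1 ≤ K₀ / τ := (one_le_div hτ0).mpr (by linarith)
          nlinarith
  -- The round that isolates `v` from `H` avoids `H`, so it cannot be heavy.
  obtain ⟨B, hBS, hB⟩ := hS.2 ((insert v H).image W.name)
    (fun m hm => by
      obtain ⟨w, -, rfl⟩ := Finset.mem_image.mp hm
      exact W.name_mem w)
    ⟨W.name v, Finset.mem_image_of_mem _ (Finset.mem_insert_self _ _)⟩
    (Finset.card_image_le.trans ((Finset.card_insert_le _ _).trans (by omega)))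
    (W.name v) (Finset.mem_image_of_mem _ (Finset.mem_insert_self _ _))
  have hvB : W.name v ∈ B := (Finset.mem_inter.mp (hB ▸ Finset.mem_singleton_self _)).1
  have hlight : ∑ w ∈ A with W.name w ∈ B, ω w ≤ τ := by
    by_contra! hheavy
    obtain ⟨w, hw, hwB⟩ := hH B (Finset.mem_filter.mpr ⟨List.mem_toFinset.mpr hBS, hheavy⟩)
    have h1 : W.name w ∈ B ∩ (insert v H).image W.name :=
      Finset.mem_inter.mpr ⟨hwB, Finset.mem_image_of_mem _ (Finset.mem_insert_of_mem hw)⟩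
    rw [hB, Finset.mem_singleton] at h1
    exact (Finset.mem_erase.mp (hHA hw)).1 (W.name_injective h1)
  have hωle : ∀ w ∈ A, W.name w ∈ B → ω w ≤ τ := fun w hw hwB =>
    (Finset.single_le_sum (f := ω) (fun w _ => (hω0 w).le)
      (Finset.mem_filter.mpr ⟨hw, hwB⟩)).trans hlight
  refine ⟨B, hBS, receives_of_interference_le M W hadj.1 (by simp [hv, hvB]) ?_ ?_ ?_⟩
  -- If `u` transmitted, it would contribute the weight 1 of the cell 0 to a light round, but `τ <
  -- 1`.
  · intro hu
    simp only [Finset.mem_filter, Finset.mem_univ, true_and] at hu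
    have h1 := hωle u (Finset.mem_erase.mpr ⟨hadj.1, hu.1⟩) hu.2
    have h2 : ω u = 1 := by
      have : gridCell (M.reach / 2) 0 = 0 := by
        ext i
        simp [gridCell]
      simp [hω, cellWeight, this]
    linarith
  · rw [dist_comm]
    exact hadj.2
  · have hset : (Finset.univ.filter fun w => w ∈ X ∧ W.name w ∈ B).erase v
        = A.filter fun w => W.name w ∈ B := by
      ext w
      simp only [hA, Finset.mem_erase, Finset.mem_filter, Finset.mem_univ, true_and]
      tauto
    rw [hset]
    calc _ ≤ ∑ w ∈ A with W.name w ∈ B, M.P * (M.reach / 2 / 2) ^ (-M.α) * ω w := by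
          refine Finset.sum_le_sum fun w hw => ?_
          rw [mul_assoc, dist_eq_norm]
          obtain ⟨hw1, hw2⟩ := Finset.mem_filter.mp hw
          exact mul_le_mul_of_nonneg_left (rpow_norm_le_cellWeight (by linarith) hℓ _
            ((hωle w hw1 hw2).trans_lt hτ4)) M.P_pos.le
      _ ≤ M.P * (M.reach / 2 / 2) ^ (-M.α) * τ := by
          rw [← Finset.mul_sum]
          exact mul_le_mul_of_nonneg_left hlight (mul_nonneg M.P_pos.le
            (Real.rpow_nonneg (by linarith) _))
      _ ≤ _ := hτI

/-! ### The effect of a sub-phase -/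

/-- When a set of density at most `g` executes `S`, every node receives the messages of all its
active neighbours. -/
def Broadcasts (M : SINRModel) {N n : ℕ} (W : Network N n) (S : List (Finset ℕ)) (g : ℕ) : Prop :=
  ∀ X : Finset (Fin n), HasDensity M W X g → ∀ v ∈ X, ∀ u, (commGraph M W).Adj u v →
    ∃ B ∈ S, Receives M W v u (Finset.univ.filter fun w => w ∈ X ∧ W.name w ∈ B)

theorem HasDensity.mono {M : SINRModel} {N n : ℕ} {W : Network N n} {X Y : Finset (Fin n)}
    {g : ℕ} (hY : HasDensity M W Y g) (hXY : X ⊆ Y) : HasDensity M W X g := fun v hv =>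
  (Finset.card_le_card (Finset.filter_subset_filter _ hXY)).trans (hY v (hXY hv))

section Execute

variable {N n : ℕ} (M : SINRModel) (W : Network N n) (S : List (Finset ℕ))
  {act : Memory → Bool}

@[simp]
theorem executeFamily_status (c : Config n) (u : Fin n) :
    ((executeFamily M W S act c).mem u).status = (c.mem u).status := by
  induction S generalizing c with
  | nil => rfl
  | cons B S ih => exact (ih _).trans rfl

@[simp]
theorem executeFamily_rounds (c : Config n) :
    (executeFamily M W S act c).rounds = c.rounds + S.length := by
  induction S generalizing c with
  | nil => rfl
  | cons B S ih =>
    refine (ih _).trans ?_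
    simp only [radioRound, List.length_cons]
    ring

/-- As activity does not depend on `heard`, the transmitters of every round are determined by the
initial configuration. -/
theorem mem_heard_executeFamily (hact : ∀ m h, act { m with heard := h } = act m)
    (c : Config n) (u : Fin n) (x : ℕ) :
    x ∈ ((executeFamily M W S act c).mem u).heard ↔ x ∈ (c.mem u).heard ∨
      ∃ B ∈ S, ∃ v, W.name v = x ∧
        Receives M W v u (Finset.univ.filter fun w => act (c.mem w) = true ∧ W.name w ∈ B) := by
  induction S generalizing c with
  | nil => simp [executeFamily]
  | cons B S ih =>
    refine (ih _).trans ?_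
    simp only [radioRound, hact, Finset.mem_union, Finset.mem_image, Finset.mem_filter,
      Finset.mem_univ, true_and, List.mem_cons, exists_eq_or_imp]
    rw [or_assoc]
    refine or_congr Iff.rfl (or_congr ?_ Iff.rfl)
    exact ⟨fun ⟨v, h1, h2⟩ => ⟨v, h2, by convert h1⟩, fun ⟨v, h1, h2⟩ => ⟨v, by convert h2, h1⟩⟩

/-- After the execution of the family, exactly the neighbours of active nodes have heard
something. -/
theorem heard_executeFamily_nonempty_iff {g : ℕ} (hS : Broadcasts M W S g)
    (hact : ∀ m h, act { m with heard := h } = act m) (c : Config n) (X : Finset (Fin n))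
    (hX : ∀ v, act (c.mem v) = true ↔ v ∈ X) (hg : HasDensity M W X g) (u : Fin n)
    (hu : (c.mem u).heard = ∅) :
    ((executeFamily M W S act c).mem u).heard.Nonempty ↔ ∃ v ∈ X, (commGraph M W).Adj u v := by
  constructor
  · rintro ⟨x, hx⟩
    rw [mem_heard_executeFamily M W S hact, hu] at hx
    obtain hx | ⟨B, -, v, -, hv⟩ := hx
    · simp at hx
    · have h1 := (Finset.mem_filter.mp hv.1).2.1
      refine ⟨v, (hX v).mp h1, ?_, ?_⟩
      · rintro rfl
        exact hv.2.1 hv.1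
      · rw [dist_comm]
        exact hv.2.2.2
  · rintro ⟨v, hv, hadj⟩
    obtain ⟨B, hB, hr⟩ := hS X hg v hv u hadj
    refine ⟨W.name v, (mem_heard_executeFamily M W S hact _ _ _).mpr (Or.inr ⟨B, hB, v, rfl, ?_⟩)⟩
    simpa only [hX] using hr

end Execute

section SubPhase

variable {N n : ℕ} (M : SINRModel) (W : Network N n) (S : List (Finset ℕ))

/-- The nodes that are workers. -/
def workers (c : Config n) : Finset (Fin n) :=
  Finset.univ.filter fun v => (c.mem v).status = .worker

@[simp]
theorem mem_workers {c : Config n} {v : Fin n} : v ∈ workers c ↔ (c.mem v).status = .worker := by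
  simp [workers]

/-- The workers that become candidates. -/
def candidates (c : Config n) (coin : Fin n → Bool) : Finset (Fin n) :=
  (workers c).filter fun v => coin v = true

open Classical in
/-- The candidates without adjacent candidates. -/
def elected (c : Config n) (coin : Fin n → Bool) : Finset (Fin n) :=
  (candidates c coin).filter fun v => ∀ u ∈ candidates c coin, ¬ (commGraph M W).Adj v u

open Classical in
theorem mem_elected {c : Config n} {coin : Fin n → Bool} {v : Fin n} :
    v ∈ elected M W c coin ↔ v ∈ candidates c coin ∧
      ∀ u ∈ candidates c coin, ¬ (commGraph M W).Adj v u := Finset.mem_filter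

open Classical in
theorem elected_subset (c : Config n) (coin : Fin n → Bool) :
    elected M W c coin ⊆ candidates c coin := Finset.filter_subset _ _

@[simp]
theorem subPhaseWith_rounds (c : Config n) (coin : Fin n → Bool) :
    (subPhaseWith M W S c coin).rounds = c.rounds + 2 * S.length := by
  simp only [subPhaseWith, Config.localStep, executeFamily_rounds]
  ring

open Classical in
/-- The statuses after a sub-phase in which the candidates are not too dense. -/
theorem subPhaseWith_status {g : ℕ} (hS : Broadcasts M W S g) (c : Config n)
    (coin : Fin n → Bool) (hc : ∀ v, (c.mem v).status ≠ .candidate)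
    (hg : HasDensity M W (candidates c coin) g) (v : Fin n) :
    ((subPhaseWith M W S c coin).mem v).status =
      if v ∈ elected M W c coin then .leader
      else if v ∈ workers c then
        if ∃ u ∈ elected M W c coin, (commGraph M W).Adj v u then .slave else .worker
      else (c.mem v).status := by
  set c₁ := c.localStep fun v => Memory.beginStage1 (coin v) with h₁
  set c₂ := executeFamily M W S (fun m => decide (m.status = .candidate)) c₁ with h₂
  set c₃ := c₂.localStep fun _ => Memory.endStage1 with h₃
  set c₄ := executeFamily M W S (fun m => m.fresh) c₃ with h₄
  have hs₁ : ∀ u, (c₁.mem u).status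
      = if u ∈ candidates c coin then .candidate else (c.mem u).status := fun u => by
    simp [h₁, Config.localStep, Memory.beginStage1, candidates]
  have hcand : ∀ u, (c₁.mem u).status = .candidate ↔ u ∈ candidates c coin := fun u => by
    rw [hs₁]
    split_ifs with h
    · simp [h]
    · simp [h, hc u]
  have hs₂ : ∀ u, (c₂.mem u).status = (c₁.mem u).status := fun u =>
    executeFamily_status M W S c₁ u
  have hh₂ : ∀ u, (c₂.mem u).heard = ∅ ↔ ∀ w ∈ candidates c coin, ¬ (commGraph M W).Adj u w :=
    fun u => by
      rw [← Finset.not_nonempty_iff_eq_empty, heard_executeFamily_nonempty_iff M W S hS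
        (fun _ _ => rfl) c₁ (candidates c coin) (by simpa using hcand) hg u rfl]
      push Not
      rfl
  have hel : ∀ u, ((c₂.mem u).status = .candidate ∧ (c₂.mem u).heard = ∅) ↔
      u ∈ elected M W c coin := fun u => by
    rw [hs₂, hcand, hh₂, elected, Finset.mem_filter]
  have hs₃ : ∀ u, (c₃.mem u).status = if u ∈ elected M W c coin then .leader
      else if u ∈ candidates c coin then .worker else (c.mem u).status := fun u => by
    have h5 := hel u
    have h6 := hcand u
    have h7 := hs₁ u
    simp only [h₃, Config.localStep, Memory.endStage1]
    rw [hs₂] at h5 ⊢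
    by_cases h : u ∈ candidates c coin
    · have h8 := h6.mpr h
      simp only [h8, true_and] at h5
      simp [h8, h5, h]
    · have h8 := fun h' => h (elected_subset M W c coin h')
      have h9 : (c₁.mem u).status ≠ .candidate := fun h' => h (h6.mp h')
      rw [if_neg h] at h7
      rw [if_neg h9, if_neg h8, if_neg h, h7]
  have hf₃ : ∀ u, (c₃.mem u).fresh = true ↔ u ∈ elected M W c coin := fun u => by
    rw [← hel]
    simp [h₃, Config.localStep, Memory.endStage1]
  have hs₄ : ∀ u, (c₄.mem u).status = (c₃.mem u).status := fun u =>
    executeFamily_status M W S c₃ u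
  -- The elected nodes are candidates and inherit their density, so Stage 2 needs no further
  -- assumption on the coins.
  have hh₄ : ∀ u, (c₄.mem u).heard.Nonempty ↔
      ∃ w ∈ elected M W c coin, (commGraph M W).Adj u w := fun u =>
    heard_executeFamily_nonempty_iff M W S hS (fun _ _ => rfl) c₃ (elected M W c coin) hf₃
      (hg.mono (elected_subset M W c coin)) u rfl
  have hfin : ((subPhaseWith M W S c coin).mem v).status =
      if (c₄.mem v).status = .worker ∧ (c₄.mem v).heard.Nonempty then .slave
      else (c₄.mem v).status := by
    change (Memory.endStage2 (c₄.mem v)).status = _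
    rw [Memory.endStage2]
    split_ifs <;> rfl
  simp only [hfin, hs₄, hs₃, hh₄]
  by_cases he : v ∈ elected M W c coin
  · simp [he]
  · by_cases hca : v ∈ candidates c coin
    · have hw : v ∈ workers c := (Finset.mem_filter.mp hca).1
      simp only [he, hca, hw, if_true, if_false, true_and]
    · by_cases hw : v ∈ workers c
      · simp only [he, hca, hw, if_true, if_false, mem_workers.mp hw, true_and]
      · have hw' := fun h => hw (mem_workers.mpr h)
        simp only [he, hca, hw, if_false]
        exact if_neg fun h => hw' h.1

/-- The invariant of the procedure: at the end of a sub-phase there are no candidates, the leaders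
are independent, and exactly the workers are neither leaders nor adjacent to leaders. -/
structure Consistent (c : Config n) : Prop where
  no_candidate : ∀ v, (c.mem v).status ≠ .candidate
  indep : ∀ u v, (c.mem u).status = .leader → (c.mem v).status = .leader →
    ¬ (commGraph M W).Adj u v
  slave : ∀ v, (c.mem v).status = .slave →
    ∃ u, (c.mem u).status = .leader ∧ (commGraph M W).Adj v u
  worker : ∀ u v, (c.mem u).status = .leader → (c.mem v).status = .worker →
    ¬ (commGraph M W).Adj u v

/-- A consistent configuration without workers yields a maximal independent set. -/
theorem Consistent.leadersFormMIS {c : Config n} (h : Consistent M W c)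
    (hw : ∀ v, (c.mem v).status ≠ .worker) : LeadersFormMIS M W c := by
  refine ⟨fun u hu v hv _ => h.indep u v hu hv, fun s hs hle v hv => ?_⟩
  by_contra hlead
  have hsl : (c.mem v).status = .slave := by
    have h1 := h.no_candidate v
    have h2 := hw v
    have h3 : (c.mem v).status ≠ .leader := hlead
    cases h4 : (c.mem v).status <;> simp_all
  obtain ⟨u, hu, hadj⟩ := h.slave v hsl
  exact hs hv (hle hu) hadj.ne hadj

theorem consistent_init : Consistent M W (⟨fun _ => Memory.init, 0⟩ : Config n) :=
  ⟨by simp [Memory.init], by simp [Memory.init], by simp [Memory.init], by simp [Memory.init]⟩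

/-- New leaders are pairwise non-adjacent since they are isolated among the candidates, and not
adjacent to old leaders since they were workers. Every worker next to a new leader hears it and
becomes a slave. -/
theorem Consistent.subPhaseWith {g : ℕ} (hS : Broadcasts M W S g) {c : Config n}
    {coin : Fin n → Bool} (hc : Consistent M W c)
    (hg : HasDensity M W (candidates c coin) g) :
    Consistent M W (subPhaseWith M W S c coin) := by
  have hst := subPhaseWith_status M W S hS c coin hc.no_candidate hg
  have helw : ∀ v, v ∈ elected M W c coin → (c.mem v).status = .worker := fun v hv =>
    mem_workers.mp (Finset.mem_filter.mp (elected_subset M W c coin hv)).1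
  have hlead : ∀ v, ((MisSWD.subPhaseWith M W S c coin).mem v).status = .leader ↔
      v ∈ elected M W c coin ∨ (c.mem v).status = .leader := fun v => by
    rw [hst]
    split_ifs with h1 h2 h3
    · simp [h1]
    · simp [h1, mem_workers.mp h2]
    · simp [h1, mem_workers.mp h2]
    · simp [h1]
  have hwork : ∀ v, ((MisSWD.subPhaseWith M W S c coin).mem v).status = .worker →
      (c.mem v).status = .worker ∧ ∀ u ∈ elected M W c coin, ¬ (commGraph M W).Adj v u :=
    fun v => by
      rw [hst]
      split_ifs with h1 h2 h3
      · simp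
      · simp
      · exact fun _ => ⟨mem_workers.mp h2, fun u hu hadj => h3 ⟨u, hu, hadj⟩⟩
      · exact fun h => absurd (mem_workers.mpr h) h2
  refine ⟨fun v => ?_, fun u v hu hv hadj => ?_, fun v hv => ?_, fun u v hu hv hadj => ?_⟩
  · rw [hst]
    split_ifs
    · simp
    · simp
    · simp
    · exact hc.no_candidate v
  · rw [hlead] at hu hv
    rcases hu with hu | hu <;> rcases hv with hv | hv
    · exact ((mem_elected M W).mp hu).2 v (elected_subset M W c coin hv) hadj
    · exact hc.worker v u hv (helw u hu) hadj.symm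
    · exact hc.worker u v hu (helw v hv) hadj
    · exact hc.indep u v hu hv hadj
  · simp only [hlead]
    rw [hst] at hv
    split_ifs at hv with h1 h2 h3
    · obtain ⟨u, hu, hadj⟩ := h3
      exact ⟨u, Or.inl hu, hadj⟩
    · obtain ⟨u, hu, hadj⟩ := hc.slave v hv
      exact ⟨u, Or.inr hu, hadj⟩
  · rw [hlead] at hu
    obtain ⟨hv1, hv2⟩ := hwork v hv
    rcases hu with hu | hu
    · exact hv2 u hu hadj.symm
    · exact hc.worker u v hu hv1 hadj

/-- A worker that stays a worker is neither elected nor adjacent to an elected node. -/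
theorem workers_subPhaseWith {g : ℕ} (hS : Broadcasts M W S g) {c : Config n}
    {coin : Fin n → Bool} (hc : Consistent M W c)
    (hg : HasDensity M W (candidates c coin) g) {v : Fin n}
    (hv : v ∈ workers (MisSWD.subPhaseWith M W S c coin)) :
    v ∈ workers c ∧ v ∉ elected M W c coin ∧
      ∀ u ∈ elected M W c coin, ¬ (commGraph M W).Adj v u := by
  rw [mem_workers, subPhaseWith_status M W S hS c coin hc.no_candidate hg] at hv
  split_ifs at hv with h1 h2 h3
  · exact ⟨h2, h1, fun u hu hadj => h3 ⟨u, hu, hadj⟩⟩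
  · exact absurd (mem_workers.mpr hv) h2

end SubPhase

open scoped ENNReal

/-! ### Independent coins -/

theorem coins_apply {n : ℕ} {p : ℝ≥0∞} (hp : p ≤ 1) (x : Fin n → Bool) :
    coins n p hp x = ∏ v, if x v = true then p else 1 - p := rfl

/-- The expectation of a product of functions of the single coins. -/
theorem sum_coins_mul_prod {n : ℕ} {p : ℝ≥0∞} (hp : p ≤ 1) (f : Fin n → Bool → ℝ≥0∞) :
    ∑ x, coins n p hp x * ∏ v, f v (x v) = ∏ v, (p * f v true + (1 - p) * f v false) := by
  have h := Finset.prod_univ_sum (fun _ : Fin n => (Finset.univ : Finset Bool))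
    (fun v b => (if b = true then p else 1 - p) * f v b)
  rw [Fintype.piFinset_univ] at h
  simp only [Fintype.sum_bool, if_true, Bool.false_eq_true, if_false] at h
  simp only [h, coins_apply, Finset.prod_mul_distrib]

/-- The indicator of the event is a product of functions of single coins, so its expectation
factorises. -/
theorem coins_toOuterMeasure_one_true {n : ℕ} {p : ℝ≥0∞} (hp : p ≤ 1) (v : Fin n)
    (A : Finset (Fin n)) (hv : v ∉ A) :
    (coins n p hp).toOuterMeasure {x | x v = true ∧ ∀ w ∈ A, x w = false} =
      p * (1 - p) ^ A.card := by
  classical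
  have h := sum_coins_mul_prod hp fun w b =>
    if w = v then (if b = true then 1 else 0) else if w ∈ A then (if b = true then 0 else 1) else 1
  rw [PMF.toOuterMeasure_apply_fintype]
  have h1 : ∀ x : Fin n → Bool,
      Set.indicator {x : Fin n → Bool | x v = true ∧ ∀ w ∈ A, x w = false} (coins n p hp) x =
      coins n p hp x * ∏ w, (if w = v then (if x w = true then (1 : ℝ≥0∞) else 0)
        else if w ∈ A then (if x w = true then 0 else 1) else 1) := by
    intro x
    by_cases hx : x v = true ∧ ∀ w ∈ A, x w = false
    · rw [Set.indicator_of_mem (by exact hx), Finset.prod_eq_one, mul_one]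
      intro w _
      split_ifs with h1 h2 h3 h4 <;> simp_all
    · rw [Set.indicator_of_notMem (by exact hx)]
      by_cases hxv : x v = true
      · have : ∃ w ∈ A, x w = true := by
          by_contra! hcon
          exact hx ⟨hxv, fun w hw => by simpa using hcon w hw⟩
        obtain ⟨w, hw, hxw⟩ := this
        have hwv : w ≠ v := fun h => hv (h ▸ hw)
        rw [Finset.prod_eq_zero (Finset.mem_univ w) (by simp [hw, hxw, hwv]), mul_zero]
      · rw [Finset.prod_eq_zero (Finset.mem_univ v) (by simp [hxv]), mul_zero]
  rw [Finset.sum_congr rfl fun x _ => h1 x, h]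
  have h2 : ∀ w : Fin n, (p * (if w = v then (if true = true then (1 : ℝ≥0∞) else 0)
        else if w ∈ A then (if true = true then 0 else 1) else 1) +
      (1 - p) * (if w = v then (if false = true then (1 : ℝ≥0∞) else 0)
        else if w ∈ A then (if false = true then 0 else 1) else 1)) =
      (if w = v then p else 1) * (if w ∈ A then 1 - p else 1) := by
    intro w
    by_cases h1 : w = v
    · subst h1
      simp [hv]
    · by_cases h2 : w ∈ A
      · simp [h1, h2]
      · simp [h1, h2, add_tsub_cancel_of_le hp]
  rw [Finset.prod_congr rfl fun w _ => h2 w, Finset.prod_mul_distrib, Finset.prod_ite_eq',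
    if_pos (Finset.mem_univ v), Finset.prod_ite_mem, Finset.univ_inter, Finset.prod_const]

/-- An upper tail bound for the number of coins in `A` that show `true`. -/
theorem coins_toOuterMeasure_tail {n : ℕ} {p : ℝ≥0∞} (hp : p ≤ 1) (A : Finset (Fin n)) (g : ℕ) :
    (coins n p hp).toOuterMeasure {x | g < (A.filter fun w => x w = true).card} ≤
      (1 + p) ^ A.card / 2 ^ g := by
  classical
  -- Markov's inequality for `2 ^ X`, where `X` counts the heads in `A`: its expectation is `(1 + p)
  -- ^ A.card`.
  have h := sum_coins_mul_prod hp fun w b => if w ∈ A then (if b = true then 2 else 1) else 1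
  have h1 : ∀ x : Fin n → Bool, (∏ w, if w ∈ A then (if x w = true then (2 : ℝ≥0∞) else 1) else 1)
      = 2 ^ (A.filter fun w => x w = true).card := fun x => by
    rw [Finset.prod_ite_mem, Finset.univ_inter, Finset.prod_ite, Finset.prod_const,
      Finset.prod_const_one, mul_one]
  have h2 : ∀ w : Fin n, (p * (if w ∈ A then (if true = true then (2 : ℝ≥0∞) else 1) else 1) +
      (1 - p) * (if w ∈ A then (if false = true then 2 else 1) else 1)) =
      if w ∈ A then 1 + p else 1 := by
    intro w
    by_cases hw : w ∈ A
    · simp only [hw, if_true, Bool.false_eq_true, if_false, mul_one]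
      rw [mul_two, add_assoc, add_tsub_cancel_of_le hp, add_comm]
    · simp [hw, add_tsub_cancel_of_le hp]
  rw [Finset.prod_congr rfl fun w _ => h2 w,
    Finset.sum_congr rfl fun x _ => congrArg (coins n p hp x * ·) (h1 x), Finset.prod_ite_mem, Finset.univ_inter,
    Finset.prod_const] at h
  rw [← h, PMF.toOuterMeasure_apply_fintype, ENNReal.div_eq_inv_mul, Finset.mul_sum]
  refine Finset.sum_le_sum fun x _ => ?_
  by_cases hx : g < (A.filter fun w => x w = true).card
  · rw [Set.indicator_of_mem (by exact hx), mul_left_comm]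
    refine le_mul_of_one_le_right' ?_
    rw [← ENNReal.div_eq_inv_mul, ENNReal.le_div_iff_mul_le (by simp) (by simp), one_mul]
    exact pow_le_pow_right₀ (by norm_num) hx.le
  · rw [Set.indicator_of_notMem (by exact hx)]
    exact zero_le

/-- The power is at most `exp (r * d) ≤ exp 2 < 8`. Here `r * d` bounds the expected number of
candidates near a worker. -/
theorem one_add_pow_le_eight {r : ℝ} {d : ℕ} (hr : 0 ≤ r) (h : r * d ≤ 2) :
    (1 + ENNReal.ofReal r) ^ d ≤ 8 := by
  rw [← ENNReal.ofReal_one, ← ENNReal.ofReal_add zero_le_one hr,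
    ← ENNReal.ofReal_pow (by linarith), show (8 : ℝ≥0∞) = ENNReal.ofReal 8 by simp]
  refine ENNReal.ofReal_le_ofReal ?_
  calc (1 + r) ^ d ≤ Real.exp r ^ d :=
        pow_le_pow_left₀ (by linarith) (by linarith [Real.add_one_le_exp r]) d
    _ = Real.exp (r * d) := by rw [← Real.exp_nat_mul, mul_comm]
    _ ≤ Real.exp 2 := Real.exp_le_exp.mpr h
    _ = Real.exp 1 * Real.exp 1 := by rw [← Real.exp_add]; norm_num
    _ ≤ 8 := by nlinarith [Real.exp_one_lt_d9, Real.exp_pos 1]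

/-! ### Repeated randomized steps -/

theorem toOuterMeasure_add_compl {σ : Type*} (μ : PMF σ) (s : Set σ) :
    μ.toOuterMeasure s + μ.toOuterMeasure sᶜ = 1 := by
  rw [PMF.toOuterMeasure_apply, PMF.toOuterMeasure_apply, ← ENNReal.tsum_add]
  simp only [Set.indicator_self_add_compl_apply]
  exact μ.tsum_coe

theorem toOuterMeasure_le_one {σ : Type*} (μ : PMF σ) (s : Set σ) : μ.toOuterMeasure s ≤ 1 := by
  rw [PMF.toOuterMeasure_apply, ← μ.tsum_coe]
  exact ENNReal.tsum_le_tsum fun x => Set.indicator_le_self _ _ x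

/-- A drift bound: if, outside an event of probability `δ`, a step preserves `Good` and reduces
the expectation of `F` by the factor `ρ`, then after `t` steps `F` is less than `1`, except with
probability `ρ ^ t * F c + t * δ`. -/
theorem repeatStep_drift {σ Ω : Type} [Fintype Ω] (μ : PMF Ω) (step : σ → Ω → σ) (Good : Set σ)
    (F : σ → ℝ≥0∞) (Bad : σ → Set Ω) (δ ρ : ℝ≥0∞)
    (hGood : ∀ c ∈ Good, ∀ ω ∉ Bad c, step c ω ∈ Good)
    (hBad : ∀ c ∈ Good, μ.toOuterMeasure (Bad c) ≤ δ)
    (hF : ∀ c ∈ Good, ∑ ω, μ ω * (Bad c)ᶜ.indicator (fun ω => F (step c ω)) ω ≤ ρ * F c)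
    (t : ℕ) : ∀ c ∈ Good,
      (repeatStep (fun c => μ.map (step c)) t c).toOuterMeasure {c | c ∈ Good ∧ F c < 1}ᶜ ≤
        ρ ^ t * F c + t * δ := by
  induction t with
  | zero =>
    intro c hc
    rw [repeatStep, PMF.toOuterMeasure_pure_apply]
    split_ifs with h
    · have : 1 ≤ F c := by
        by_contra! hlt
        exact h ⟨hc, hlt⟩
      simpa using this
    · exact zero_le
  | succ t ih =>
    intro c hc
    rw [repeatStep, PMF.bind_map, PMF.toOuterMeasure_bind_apply, tsum_fintype]
    -- Condition on the first step: a bad outcome is charged its full probability, any other outcome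
    -- the induction bound.
    calc _ ≤ ∑ ω, ((Bad c).indicator μ ω + (ρ ^ t * (μ ω * (Bad c)ᶜ.indicator
            (fun ω => F (step c ω)) ω) + μ ω * (t * δ))) := by
          refine Finset.sum_le_sum fun ω _ => ?_
          by_cases hω : ω ∈ Bad c
          · rw [Set.indicator_of_mem hω]
            exact le_add_right (mul_le_of_le_one_right' (toOuterMeasure_le_one _ _))
          · rw [Set.indicator_of_notMem hω, Set.indicator_of_mem (show ω ∈ (Bad c)ᶜ from hω),
              zero_add]
            refine (mul_le_mul_right (ih _ (hGood c hc ω hω)) _).trans (le_of_eq ?_)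
            ring
      _ = μ.toOuterMeasure (Bad c) + (ρ ^ t * ∑ ω, μ ω * (Bad c)ᶜ.indicator
            (fun ω => F (step c ω)) ω + t * δ) := by
          have h1 : ∑ ω, μ ω = 1 := by rw [← μ.tsum_coe, tsum_fintype]
          rw [Finset.sum_add_distrib, Finset.sum_add_distrib, ← Finset.mul_sum, ← Finset.sum_mul,
            PMF.toOuterMeasure_apply_fintype, h1, one_mul]
      _ ≤ δ + (ρ ^ t * (ρ * F c) + t * δ) := by
          gcongr
          · exact hBad c hc
          · exact hF c hc
      _ = _ := by
          push_cast
          ring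

/-- If every phase establishes the next invariant up to an error `e`, then all the phases together
establish the last invariant up to the sum of the errors. -/
theorem foldlM_invariant {σ : Type} {k : ℕ} (f : σ → Fin k → PMF σ) (I : ℕ → Set σ) (e : ℝ≥0∞)
    (h : ∀ i : Fin k, ∀ c ∈ I i, (f c i).toOuterMeasure (I (i + 1))ᶜ ≤ e) (l : List (Fin k)) :
    ∀ j, l.map Fin.val = List.range' j l.length → ∀ c ∈ I j,
      (l.foldlM f c).toOuterMeasure (I (j + l.length))ᶜ ≤ l.length * e := by
  induction l with
  | nil =>
    intro j _ c hc
    simp only [List.foldlM_nil, List.length_nil, add_zero]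
    change (PMF.pure c).toOuterMeasure _ ≤ _
    rw [PMF.toOuterMeasure_pure_apply, if_neg (by simpa using hc)]
    exact zero_le
  | cons i l ih =>
    intro j hj c hc
    simp only [List.map_cons, List.length_cons, List.range'_succ, List.cons.injEq] at hj
    obtain ⟨rfl, hl⟩ := hj
    rw [List.foldlM_cons]
    change ((f c i).bind fun c => l.foldlM f c).toOuterMeasure _ ≤ _
    rw [PMF.toOuterMeasure_bind_apply]
    calc _ ≤ ∑' c', ((I (i + 1))ᶜ.indicator (f c i) c' + f c i c' * (l.length * e)) := by
          refine ENNReal.tsum_le_tsum fun c' => ?_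
          by_cases hc' : c' ∈ I (i + 1)
          · have h1 := ih (i + 1) hl c' hc'
            rw [List.length_cons, show (i : ℕ) + (l.length + 1) = i + 1 + l.length by ring]
            exact le_add_left (mul_le_mul_right h1 _)
          · rw [Set.indicator_of_mem (show c' ∈ (I (i + 1))ᶜ from hc')]
            exact le_add_right (mul_le_of_le_one_right' (toOuterMeasure_le_one _ _))
      _ = (f c i).toOuterMeasure (I (i + 1))ᶜ + l.length * e := by
          rw [ENNReal.tsum_add, ENNReal.tsum_mul_right, PMF.tsum_coe, one_mul,
            PMF.toOuterMeasure_apply]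
      _ ≤ e + l.length * e := by
          gcongr
          exact h i c hc
      _ = _ := by
          rw [List.length_cons]
          push_cast
          ring

/-! ### One phase -/

section Phase

variable {N n : ℕ} (M : SINRModel) (W : Network N n) (S : List (Finset ℕ))

open Classical in
/-- The workers adjacent to a node. -/
def workerNeighbours (c : Config n) (u : Fin n) : Finset (Fin n) :=
  (workers c).filter fun w => (commGraph M W).Adj u w

open Classical in
@[simp]
theorem mem_workerNeighbours {c : Config n} {u w : Fin n} :
    w ∈ workerNeighbours M W c u ↔ w ∈ workers c ∧ (commGraph M W).Adj u w := Finset.mem_filter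

/-- The workers with at least `h` adjacent workers. -/
def crowded (h : ℕ) (c : Config n) : Finset (Fin n) :=
  (workers c).filter fun u => h ≤ (workerNeighbours M W c u).card

/-- The consistent configurations in which every worker has at most `D` adjacent workers. -/
def sparse (D : ℕ) : Set (Config n) :=
  {c | Consistent M W c ∧ ∀ u ∈ workers c, (workerNeighbours M W c u).card ≤ D}

/-- The outcomes of the coins for which the candidates are too dense. -/
def denseCoins (g : ℕ) (c : Config n) : Set (Fin n → Bool) :=
  {coin | ¬ HasDensity M W (candidates c coin) g}

/-- The outcomes of the coins for which `u` or one of its neighbours is elected. -/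
def coveringCoins (c : Config n) (u : Fin n) : Set (Fin n → Bool) :=
  {coin | u ∈ elected M W c coin ∨ ∃ w ∈ elected M W c coin, (commGraph M W).Adj u w}

open Classical in
/-- Too many candidates near some node are unlikely. -/
theorem coins_denseCoins_le {r : ℝ} (hr0 : 0 ≤ r) (hp : ENNReal.ofReal r ≤ 1) {D : ℕ} (g : ℕ)
    (hD : r * (D + 1) ≤ 2) {c : Config n} (hc : c ∈ sparse M W D) :
    (coins n (ENNReal.ofReal r) hp).toOuterMeasure (denseCoins M W g c) ≤ n * (8 / 2 ^ g) := by
  set A : Fin n → Finset (Fin n) := fun v =>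
    (workers c).filter fun w => dist (W.pos v) (W.pos w) ≤ M.reach with hA
  have hsub : denseCoins M W g c ⊆ ⋃ v ∈ workers c,
      {coin | g < ((A v).filter fun w => coin w = true).card} := by
    intro coin hcoin
    simp only [denseCoins, HasDensity, Set.mem_ofPred_eq, not_forall, not_le, exists_prop] at hcoin
    obtain ⟨v, hv, hg⟩ := hcoin
    simp only [Set.mem_iUnion, Set.mem_ofPred_eq, exists_prop]
    refine ⟨v, (Finset.mem_filter.mp hv).1, hg.trans_le (Finset.card_le_card fun w hw => ?_)⟩
    simp only [hA, candidates, Finset.mem_filter] at hw ⊢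
    tauto
  -- The disc about `v` contains `v` itself, whence `D + 1`.
  have hcard : ∀ v ∈ workers c, (A v).card ≤ D + 1 := by
    intro v hv
    have h1 : A v ⊆ insert v (workerNeighbours M W c v) := by
      intro w hw
      simp only [hA, Finset.mem_filter] at hw
      rw [Finset.mem_insert, mem_workerNeighbours]
      by_cases h : w = v
      · exact Or.inl h
      · exact Or.inr ⟨hw.1, fun h' => h h'.symm, hw.2⟩
    exact (Finset.card_le_card h1).trans ((Finset.card_insert_le _ _).trans
      (Nat.succ_le_succ (hc.2 v hv)))
  calc _ ≤ ∑ v ∈ workers c, (coins n (ENNReal.ofReal r) hp).toOuterMeasure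
        {coin | g < ((A v).filter fun w => coin w = true).card} :=
        (MeasureTheory.measure_mono hsub).trans (MeasureTheory.measure_biUnion_finset_le _ _)
    _ ≤ ∑ v ∈ workers c, (8 / 2 ^ g : ℝ≥0∞) := by
        refine Finset.sum_le_sum fun v hv => (coins_toOuterMeasure_tail hp (A v) g).trans ?_
        refine ENNReal.div_le_div_right (one_add_pow_le_eight hr0 (le_trans ?_ hD)) _
        have h1 : ((A v).card : ℝ) ≤ D + 1 := by exact_mod_cast hcard v hv
        exact mul_le_mul_of_nonneg_left h1 hr0
    _ ≤ n * (8 / 2 ^ g) := by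
        rw [Finset.sum_const, nsmul_eq_mul]
        have h1 : (workers c).card ≤ n := by simpa using Finset.card_le_univ (workers c)
        gcongr

open Classical in
/-- A crowded worker is likely to be elected or to have an elected neighbour. -/
theorem le_coins_coveringCoins {r : ℝ} (hr0 : 0 ≤ r) (hr1 : r ≤ 1)
    (hp : ENNReal.ofReal r ≤ 1) {D h : ℕ} (hD : 1 / 32 ≤ (h + 1) * (r * (1 - r) ^ (2 * D)))
    {c : Config n} (hc : c ∈ sparse M W D) {u : Fin n} (hu : u ∈ crowded M W h c) :
    32⁻¹ ≤ (coins n (ENNReal.ofReal r) hp).toOuterMeasure (coveringCoins M W c u) := by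
  obtain ⟨huw, huh⟩ := Finset.mem_filter.mp hu
  set V := insert u (workerNeighbours M W c u) with hV
  -- If `v` alone among `V` and its own worker neighbours is a candidate, it is elected. Requiring
  -- silence on all of `V` makes these events disjoint for different `v` in `V`, so their
  -- probabilities add up.
  set A : Fin n → Finset (Fin n) := fun v =>
    (V ∪ workerNeighbours M W c v).erase v with hA
  have hVw : ∀ v ∈ V, v ∈ workers c := fun v hv => by
    rcases Finset.mem_insert.mp hv with rfl | h
    · exact huw
    · exact ((mem_workerNeighbours M W).mp h).1
  have huV : u ∉ workerNeighbours M W c u := fun h =>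
    ((mem_workerNeighbours M W).mp h).2.ne rfl
  have hVcard : V.card = (workerNeighbours M W c u).card + 1 := Finset.card_insert_of_notMem huV
  -- The count is `(D + 1) + D - 1`, as `v` is removed from the union.
  have hAcard : ∀ v ∈ V, (A v).card ≤ 2 * D := by
    intro v hv
    have h1 : (A v).card ≤ (V ∪ workerNeighbours M W c v).card - 1 :=
      (Finset.card_erase_of_mem (Finset.mem_union_left _ hv)).le
    have h2 := Finset.card_union_le V (workerNeighbours M W c v)
    have h3 := hc.2 u huw
    have h4 := hc.2 v (hVw v hv)
    omega
  set E : Fin n → Set (Fin n → Bool) := fun v => {x | x v = true ∧ ∀ w ∈ A v, x w = false} with hE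
  have hsub : ∀ v ∈ V, E v ⊆ coveringCoins M W c u := by
    rintro v hv x ⟨hx1, hx2⟩
    have hel : v ∈ elected M W c x := by
      rw [mem_elected]
      refine ⟨Finset.mem_filter.mpr ⟨hVw v hv, hx1⟩, fun w hw hadj => ?_⟩
      obtain ⟨hw1, hw2⟩ := Finset.mem_filter.mp hw
      have := hx2 w (Finset.mem_erase.mpr ⟨hadj.ne', Finset.mem_union_right _
        ((mem_workerNeighbours M W).mpr ⟨hw1, hadj⟩)⟩)
      simp [this] at hw2
    rcases Finset.mem_insert.mp hv with rfl | h
    · exact Or.inl hel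
    · exact Or.inr ⟨v, hel, ((mem_workerNeighbours M W).mp h).2⟩
  have hdisj : ∀ x, ∀ v ∈ V, ∀ w ∈ V, x ∈ E v → x ∈ E w → v = w := by
    rintro x v hv w hw ⟨-, hx2⟩ ⟨hy1, -⟩
    by_contra hne
    have := hx2 w (Finset.mem_erase.mpr ⟨Ne.symm hne, Finset.mem_union_left _ hw⟩)
    simp [this] at hy1
  set μ := coins n (ENNReal.ofReal r) hp with hμ
  have hsum : ∑ v ∈ V, μ.toOuterMeasure (E v) ≤ μ.toOuterMeasure (coveringCoins M W c u) := by
    simp only [PMF.toOuterMeasure_apply_fintype]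
    rw [Finset.sum_comm]
    refine Finset.sum_le_sum fun x _ => ?_
    by_cases hx : ∃ v ∈ V, x ∈ E v
    · obtain ⟨v, hv, hxv⟩ := hx
      rw [Finset.sum_eq_single_of_mem v hv fun w hw hwv =>
          Set.indicator_of_notMem (fun hxw => hwv (hdisj x w hw v hv hxw hxv)) _,
        Set.indicator_of_mem hxv, Set.indicator_of_mem (hsub v hv hxv)]
    · push Not at hx
      rw [Finset.sum_eq_zero fun v hv => Set.indicator_of_notMem (hx v hv) _]
      exact zero_le
  refine le_trans ?_ hsum
  have h1r : (1 : ℝ≥0∞) - ENNReal.ofReal r = ENNReal.ofReal (1 - r) := by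
    rw [ENNReal.ofReal_sub _ hr0, ENNReal.ofReal_one]
  calc (32⁻¹ : ℝ≥0∞) = ENNReal.ofReal (1 / 32) := by
        rw [one_div, ENNReal.ofReal_inv_of_pos (by norm_num)]
        simp
    _ ≤ ENNReal.ofReal ((h + 1 : ℕ) * (r * (1 - r) ^ (2 * D))) :=
        ENNReal.ofReal_le_ofReal (by push_cast; exact hD)
    _ = ((h + 1 : ℕ) : ℝ≥0∞) * (ENNReal.ofReal r * (1 - ENNReal.ofReal r) ^ (2 * D)) := by
        rw [ENNReal.ofReal_mul (by positivity), ENNReal.ofReal_mul hr0,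
          ENNReal.ofReal_pow (by linarith), h1r, ENNReal.ofReal_natCast]
    _ ≤ V.card * (ENNReal.ofReal r * (1 - ENNReal.ofReal r) ^ (2 * D)) := by
        have : h + 1 ≤ V.card := by omega
        gcongr
    _ = ∑ v ∈ V, ENNReal.ofReal r * (1 - ENNReal.ofReal r) ^ (2 * D) := by
        rw [Finset.sum_const, nsmul_eq_mul]
    _ ≤ _ := by
        refine Finset.sum_le_sum fun v hv => ?_
        rw [hμ, hE, coins_toOuterMeasure_one_true hp v (A v) (Finset.notMem_erase _ _)]
        exact mul_le_mul_right (pow_le_pow_right_of_le_one' tsub_le_self (hAcard v hv)) _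

theorem workers_subPhaseWith_subset {g : ℕ} (hS : Broadcasts M W S g) {c : Config n}
    {coin : Fin n → Bool} (hc : Consistent M W c) (hg : coin ∉ denseCoins M W g c) :
    workers (subPhaseWith M W S c coin) ⊆ workers c := fun _ hv =>
  (workers_subPhaseWith M W S hS hc (not_not.mp hg) hv).1

theorem workerNeighbours_mono {c c' : Config n} (h : workers c' ⊆ workers c) (u : Fin n) :
    workerNeighbours M W c' u ⊆ workerNeighbours M W c u := fun w hw => by
  rw [mem_workerNeighbours] at hw ⊢
  exact ⟨h hw.1, hw.2⟩

theorem sparse_subPhaseWith {g D : ℕ} (hS : Broadcasts M W S g) {c : Config n}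
    (hc : c ∈ sparse M W D) {coin : Fin n → Bool} (hg : coin ∉ denseCoins M W g c) :
    subPhaseWith M W S c coin ∈ sparse M W D := by
  have hsub := workers_subPhaseWith_subset M W S hS hc.1 hg
  exact ⟨hc.1.subPhaseWith M W S hS (not_not.mp hg), fun u hu =>
    (Finset.card_le_card (workerNeighbours_mono M W hsub u)).trans (hc.2 u (hsub hu))⟩

open Classical in
-- The set of workers only shrinks, so nobody becomes crowded anew, and a covered worker stops being
-- a worker.
theorem crowded_subPhaseWith_subset {g h : ℕ} (hS : Broadcasts M W S g) {c : Config n}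
    (hc : Consistent M W c) {coin : Fin n → Bool} (hg : coin ∉ denseCoins M W g c) :
    crowded M W h (subPhaseWith M W S c coin) ⊆
      (crowded M W h c).filter fun u => coin ∉ coveringCoins M W c u := fun u hu => by
  obtain ⟨hu1, hu2⟩ := Finset.mem_filter.mp hu
  obtain ⟨h1, h2, h3⟩ := workers_subPhaseWith M W S hS hc (not_not.mp hg) hu1
  have hsub := workers_subPhaseWith_subset M W S hS hc hg
  refine Finset.mem_filter.mpr ⟨Finset.mem_filter.mpr ⟨h1, hu2.trans
    (Finset.card_le_card (workerNeighbours_mono M W hsub u))⟩, ?_⟩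
  rintro (h | ⟨w, hw, hadj⟩)
  · exact h2 h
  · exact h3 w hw hadj

/-- After a phase no worker is crowded, except with small probability. -/
theorem phase_drift {g : ℕ} (hS : Broadcasts M W S g) {r : ℝ} (hr0 : 0 ≤ r) (hr1 : r ≤ 1)
    (hp : ENNReal.ofReal r ≤ 1) {D h : ℕ} (hD : r * (D + 1) ≤ 2)
    (hDh : 1 / 32 ≤ (h + 1) * (r * (1 - r) ^ (2 * D))) (m : ℕ) {c : Config n}
    (hc : c ∈ sparse M W D) :
    (repeatStep (fun c => (coins n (ENNReal.ofReal r) hp).map (subPhaseWith M W S c)) m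
      c).toOuterMeasure {c | c ∈ sparse M W D ∧ crowded M W h c = ∅}ᶜ ≤
        (1 - 32⁻¹) ^ m * n + m * (n * (8 / 2 ^ g)) := by
  classical
  set μ := coins n (ENNReal.ofReal r) hp with hμ
  have hcov : ∀ c ∈ sparse M W D, ∀ u ∈ crowded M W h c,
      μ.toOuterMeasure (coveringCoins M W c u)ᶜ ≤ 1 - 32⁻¹ := by
    intro c hc u hu
    have h1 := le_coins_coveringCoins M W hr0 hr1 hp hDh hc hu
    refine ENNReal.le_sub_of_add_le_left (by simp) ?_
    rw [← toOuterMeasure_add_compl μ (coveringCoins M W c u)]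
    gcongr
  have hmain := repeatStep_drift μ (subPhaseWith M W S) (sparse M W D)
    -- The potential is the number of crowded workers; being an integer, it vanishes once it is
    -- below 1.
    (fun c => ((crowded M W h c).card : ℝ≥0∞)) (denseCoins M W g) (n * (8 / 2 ^ g)) (1 - 32⁻¹)
    (fun c hc coin hcoin => sparse_subPhaseWith M W S hS hc hcoin)
    (fun c hc => coins_denseCoins_le M W hr0 hp g hD hc) ?_ m c hc
  · have hset : {c : Config n | c ∈ sparse M W D ∧ ((crowded M W h c).card : ℝ≥0∞) < 1} =
        {c | c ∈ sparse M W D ∧ crowded M W h c = ∅} := by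
      ext c
      simp only [Set.mem_ofPred_eq]
      rw [← Nat.cast_one, Nat.cast_lt, Nat.lt_one_iff, Finset.card_eq_zero]
    rw [hset] at hmain
    refine hmain.trans ?_
    have h1 : (crowded M W h c).card ≤ n := by simpa using Finset.card_le_univ (crowded M W h c)
    gcongr
  · intro c hc
    calc _ ≤ ∑ coin, ∑ u ∈ crowded M W h c, (coveringCoins M W c u)ᶜ.indicator μ coin := by
          refine Finset.sum_le_sum fun coin _ => ?_
          by_cases hcoin : coin ∈ denseCoins M W g c
          · rw [Set.indicator_of_notMem (by simpa using hcoin), mul_zero]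
            exact zero_le
          · rw [Set.indicator_of_mem (by simpa using hcoin)]
            have h1 := Finset.card_le_card
              (crowded_subPhaseWith_subset M W S (h := h) hS hc.1 hcoin)
            calc _ ≤ μ coin *
                  (((crowded M W h c).filter fun u => coin ∉ coveringCoins M W c u).card : ℝ≥0∞) := by
                  gcongr
              _ = _ := by
                  rw [Finset.card_filter, Nat.cast_sum, Finset.mul_sum]
                  refine Finset.sum_congr rfl fun u _ => ?_
                  by_cases hu : coin ∈ coveringCoins M W c u <;> simp [hu]
      _ = ∑ u ∈ crowded M W h c, μ.toOuterMeasure (coveringCoins M W c u)ᶜ := by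
          rw [Finset.sum_comm]
          simp only [PMF.toOuterMeasure_apply_fintype]
      _ ≤ ∑ u ∈ crowded M W h c, (1 - 32⁻¹ : ℝ≥0∞) := Finset.sum_le_sum (hcov c hc)
      _ = _ := by rw [Finset.sum_const, nsmul_eq_mul, mul_comm]

end Phase

/-! ### The whole procedure -/

/-- `(1 - 1 / d) ^ (2 * d)` is bounded from below, for powers of two `d ≥ 2`. -/
theorem one_sub_inv_two_pow_pow (j : ℕ) :
    (1 / 16 : ℝ) ≤ (1 - 1 / 2 ^ (j + 1)) ^ (2 * 2 ^ (j + 1)) := by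
  have h0 : (1 : ℝ) / 2 ^ (j + 1) ≤ 1 := by
    rw [div_le_one (by positivity)]
    exact one_le_pow₀ (by norm_num)
  -- Bernoulli's inequality for the exponent `d / 2`, with `d = 2 ^ (j + 1)`; the fourth power then
  -- gives the exponent `2 * d`.
  have h1 : (1 / 2 : ℝ) ≤ (1 - 1 / 2 ^ (j + 1)) ^ 2 ^ j := by
    have h := one_add_mul_le_pow (a := -(1 / 2 ^ (j + 1) : ℝ)) (by linarith) (2 ^ j)
    rw [← sub_eq_add_neg] at h
    refine le_trans (le_of_eq ?_) h
    push_cast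
    rw [pow_succ]
    field_simp
    norm_num
  calc (1 / 16 : ℝ) = (1 / 2) ^ 4 := by norm_num
    _ ≤ ((1 - 1 / 2 ^ (j + 1)) ^ 2 ^ j) ^ 4 := pow_le_pow_left₀ (by norm_num) h1 4
    _ = _ := by
        rw [← pow_mul]
        congr 1
        ring

/-- The bound for the number of adjacent workers at the beginning of phase `i`. -/
def degreeBound (k i : ℕ) : ℕ := if i < k then 2 ^ (k - i) else 0

section Procedure

variable {N n : ℕ} (M : SINRModel) (W : Network N n) (S : List (Finset ℕ))

/-- The invariant at the beginning of phase `i`, or at termination for `i = k + 1`. -/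
def phaseInvariant (k i : ℕ) : Set (Config n) :=
  {c | c ∈ sparse M W (degreeBound k i) ∧ (i = k + 1 → workers c = ∅)}

/-- The probability of phase `i` is matched to the degree bound: `r = 1 / D` for `i < k`, where
removing workers with at least `D / 2` adjacent workers yields the next bound. In phase `k`, where
`D = 0` and `r = 1`, it is the workers themselves that disappear. -/
theorem phase_invariant_step {g : ℕ} (hS : Broadcasts M W S g) (m k : ℕ) (i : Fin (k + 1))
    {c : Config n} (hc : c ∈ phaseInvariant M W k i) :
    (phase M W S m k c i).toOuterMeasure (phaseInvariant M W k (i + 1))ᶜ ≤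
      (1 - 32⁻¹) ^ m * n + m * (n * (8 / 2 ^ g)) := by
  set r : ℝ := 1 / 2 ^ (k - i) with hr
  have hik : (i : ℕ) ≤ k := Nat.lt_succ_iff.mp i.2
  have hr0 : 0 ≤ r := by positivity
  have hr1 : r ≤ 1 := by
    rw [hr, div_le_one (by positivity)]
    exact one_le_pow₀ (by norm_num)
  have hprob : (2 : ℝ≥0∞) ^ (i : ℕ) / 2 ^ k = ENNReal.ofReal r := by
    have h1 : r = 2 ^ (i : ℕ) / 2 ^ k := by
      rw [hr, pow_sub₀ _ two_ne_zero hik]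
      field_simp
    rw [h1, ENNReal.ofReal_div_of_pos (by positivity), ENNReal.ofReal_pow (by norm_num),
      ENNReal.ofReal_pow (by norm_num)]
    simp
  have hp : ENNReal.ofReal r ≤ 1 := ENNReal.ofReal_le_one.mpr hr1
  have hphase : phase M W S m k c i = repeatStep
      (fun c => (coins n (ENNReal.ofReal r) hp).map (subPhaseWith M W S c)) m c := by
    rw [phase]
    congr! 4
  rw [hphase]
  rcases hik.lt_or_eq with hlt | heq
  · obtain ⟨j, hj⟩ : ∃ j, k - i = j + 1 := ⟨k - i - 1, by omega⟩
    have hDi : degreeBound k i = 2 ^ (j + 1) := by rw [degreeBound, if_pos hlt, hj]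
    rw [hj] at hr
    refine le_trans (MeasureTheory.measure_mono ?_) (phase_drift M W S hS hr0 hr1 hp
      (D := degreeBound k i) (h := 2 ^ j) ?_ ?_ m hc.1)
    · refine Set.compl_subset_compl.mpr ?_
      rintro c' ⟨h1, h2⟩
      refine ⟨⟨h1.1, fun u hu => ?_⟩, fun h => by omega⟩
      have h3 : (workerNeighbours M W c' u).card < 2 ^ j := by
        by_contra! h
        exact Finset.notMem_empty u (h2 ▸ Finset.mem_filter.mpr ⟨hu, h⟩)
      rw [degreeBound]
      split_ifs with h4
      · rw [show k - (i + 1) = j by omega]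
        exact h3.le
      · rw [show j = 0 by omega] at h3
        omega
    · rw [hDi, mul_add, mul_one, hr]
      push_cast
      rw [one_div_mul_cancel (by positivity)]
      linarith
    · have h1 := one_sub_inv_two_pow_pow j
      rw [hDi, ← mul_assoc, hr]
      have h2 : (1 / 2 : ℝ) ≤ ((2 ^ j : ℕ) + 1) * (1 / 2 ^ (j + 1)) := by
        push_cast
        rw [mul_one_div, le_div_iff₀ (by positivity), pow_succ]
        linarith
      calc (1 / 32 : ℝ) = 1 / 2 * (1 / 16) := by norm_num
        _ ≤ _ := mul_le_mul h2 h1 (by norm_num) (by positivity)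
  · have hDi : degreeBound k i = 0 := by rw [degreeBound, if_neg (by omega)]
    have hr' : r = 1 := by rw [hr, heq]; simp
    -- With threshold 0 every worker counts as crowded. The factor `(1 - r) ^ (2 * D)` is `0 ^ 0 =
    -- 1`.
    refine le_trans (MeasureTheory.measure_mono ?_) (phase_drift M W S hS hr0 hr1 hp
      (D := degreeBound k i) (h := 0) ?_ ?_ m hc.1)
    · refine Set.compl_subset_compl.mpr ?_
      rintro c' ⟨h1, h2⟩
      have h3 : workers c' = ∅ := by
        rw [← h2, crowded, Finset.filter_true_of_mem]
        exact fun _ _ => Nat.zero_le _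
      exact ⟨⟨h1.1, fun u hu => by simp [h3] at hu⟩, fun _ => h3⟩
    · rw [hDi, hr']
      norm_num
    · rw [hDi, hr']
      norm_num

/-- The leaders at termination form a maximal independent set, except with small probability. -/
theorem misSWD_compl_le {g : ℕ} (hS : Broadcasts M W S g) (m : ℕ) {Δ : ℕ} (hΔ : maxDeg M W = Δ)
    (hΔ2 : 2 ≤ Δ) :
    (misSWD M W S m Δ).toOuterMeasure {c | LeadersFormMIS M W c}ᶜ ≤
      (Nat.clog 2 Δ + 1 : ℕ) * ((1 - 32⁻¹) ^ m * n + m * (n * (8 / 2 ^ g))) := by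
  classical
  set k := Nat.clog 2 Δ with hk
  -- Needed so that the initial degree bound is `2 ^ k` and not the terminal value 0.
  have hk0 : 0 < k := Nat.clog_pos (by norm_num) hΔ2
  have hinit : (⟨fun _ => Memory.init, 0⟩ : Config n) ∈ phaseInvariant M W k 0 := by
    refine ⟨⟨consistent_init M W, fun u _ => ?_⟩, fun h => by omega⟩
    rw [degreeBound, if_pos hk0]
    calc _ ≤ (commGraph M W).degree u := by
          rw [← SimpleGraph.card_neighborFinset_eq_degree]
          refine Finset.card_le_card fun w hw => ?_
          rw [SimpleGraph.mem_neighborFinset]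
          exact ((mem_workerNeighbours M W).mp hw).2
      _ ≤ maxDeg M W := by
          rw [maxDeg]
          convert SimpleGraph.degree_le_maxDegree (commGraph M W) u
      _ ≤ 2 ^ (k - 0) := by
          rw [hΔ]
          exact Nat.le_pow_clog (by norm_num) Δ
  have h := foldlM_invariant (phase M W S m k) (phaseInvariant M W k)
    ((1 - 32⁻¹) ^ m * n + m * (n * (8 / 2 ^ g)))
    (fun i c hc => phase_invariant_step M W S hS m k i hc) (List.finRange (k + 1)) 0
    (by rw [List.map_coe_finRange_eq_range, List.length_finRange, List.range_eq_range'])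
    _ hinit
  rw [List.length_finRange, zero_add] at h
  refine le_trans (MeasureTheory.measure_mono (Set.compl_subset_compl.mpr ?_)) h
  rintro c ⟨hc1, hc2⟩
  refine hc1.1.leadersFormMIS M W fun v hv => ?_
  have := mem_workers.mpr hv
  rw [hc2 rfl] at this
  exact Finset.notMem_empty _ this

theorem repeatStep_rounds {s : ℕ} (f : Config n → PMF (Config n))
    (hf : ∀ c, ∀ c' ∈ (f c).support, c'.rounds = c.rounds + s) (m : ℕ) :
    ∀ c, ∀ c' ∈ (repeatStep f m c).support, c'.rounds = c.rounds + m * s := by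
  induction m with
  | zero =>
    intro c c' hc'
    rw [repeatStep, PMF.support_pure, Set.mem_singleton_iff] at hc'
    simp [hc']
  | succ m ih =>
    intro c c' hc'
    rw [repeatStep, PMF.mem_support_bind_iff] at hc'
    obtain ⟨c₁, h1, h2⟩ := hc'
    rw [ih c₁ c' h2, hf c c₁ h1]
    ring

theorem phase_rounds (m k : ℕ) (c : Config n) (i : Fin (k + 1)) :
    ∀ c' ∈ (phase M W S m k c i).support, c'.rounds = c.rounds + m * (2 * S.length) := by
  refine repeatStep_rounds _ (fun c c' hc' => ?_) m c
  rw [PMF.mem_support_map_iff] at hc'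
  obtain ⟨x, -, rfl⟩ := hc'
  exact subPhaseWith_rounds M W S c x

theorem foldlM_rounds {ι : Type} {s : ℕ} (f : Config n → ι → PMF (Config n))
    (hf : ∀ c i, ∀ c' ∈ (f c i).support, c'.rounds = c.rounds + s) (l : List ι) :
    ∀ c, ∀ c' ∈ (l.foldlM f c).support, c'.rounds = c.rounds + l.length * s := by
  induction l with
  | nil =>
    intro c c' hc'
    change c' ∈ (PMF.pure c).support at hc'
    rw [PMF.support_pure, Set.mem_singleton_iff] at hc'
    simp [hc']
  | cons i l ih =>
    intro c c' hc'
    rw [List.foldlM_cons] at hc'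
    change c' ∈ ((f c i).bind fun c => l.foldlM f c).support at hc'
    rw [PMF.mem_support_bind_iff] at hc'
    obtain ⟨c₁, h1, h2⟩ := hc'
    rw [ih c₁ c' h2, hf c i c₁ h1, List.length_cons]
    ring

/-- The number of rounds until termination. -/
theorem misSWD_rounds (m Δ : ℕ) :
    ∀ c ∈ (misSWD M W S m Δ).support,
      c.rounds = (Nat.clog 2 Δ + 1) * (m * (2 * S.length)) := by
  intro c hc
  have h := foldlM_rounds _ (phase_rounds M W S m (Nat.clog 2 Δ)) _ _ c hc
  rw [h, List.length_finRange, zero_add]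

end Procedure

/-! ### The choice of the constants -/

/-- The admissible length of the family grows with `b`, and the hitting set, which must fit into `b
log³ N`, grows with the length. Only the logarithm of the length matters, so a large `b` suffices.
The 21 stems from `g ≤ 21 log N`, the 7 from `log⁷ N`, and the 2 from rounding up and from the
transmitter itself. -/
theorem exists_large_constant {K : ℝ} (hK : 1 ≤ K) :
    ∃ b : ℝ, 0 < b ∧ 21 * K * (Real.log (10 * (b + 1) ^ 2 + 1) + 7) + 2 ≤ b := by
  -- With this constant, `21 * K * (2 * log y)` is at most `y / 2`.
  have hc : (0 : ℝ) < 1 / (84 * K) := by positivity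
  have h1 := (Real.isLittleO_log_id_atTop.bound hc).and
    (Filter.eventually_ge_atTop (2 * (21 * K * (Real.log 11 + 7) + 2) + 2))
  obtain ⟨y, hy1, hy2⟩ := h1.exists
  have hlog11 : 0 ≤ Real.log 11 := Real.log_nonneg (by norm_num)
  have hy0 : 2 < y := by nlinarith [mul_nonneg (by linarith : (0:ℝ) ≤ 21 * K) hlog11]
  refine ⟨y - 1, by linarith, ?_⟩
  rw [sub_add_cancel]
  have h2 : Real.log (10 * y ^ 2 + 1) ≤ Real.log 11 + 2 * Real.log y := by
    have h : Real.log 11 + 2 * Real.log y = Real.log (11 * y ^ 2) := by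
      rw [Real.log_mul (by norm_num) (by positivity), Real.log_pow, Nat.cast_two]
    rw [h]
    exact Real.log_le_log (by positivity) (by nlinarith)
  have h3 : Real.log y ≤ 1 / (84 * K) * y := by
    have := (le_abs_self _).trans hy1
    rwa [id, Real.norm_of_nonneg (by linarith)] at this
  have h4 : 21 * K * (2 * Real.log y) ≤ y / 2 := by
    calc _ ≤ 21 * K * (2 * (1 / (84 * K) * y)) := by gcongr
      _ = y / 2 := by
        field_simp
        norm_num
  have h5 : 21 * K * (Real.log (10 * y ^ 2 + 1) + 7) ≤
      21 * K * (Real.log 11 + 2 * Real.log y + 7) := by gcongr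
  nlinarith

section Logarithms

variable {N : ℕ}

theorem one_le_logb_two (hN : 2 ≤ N) : 1 ≤ Real.logb 2 N := by
  rw [Real.le_logb_iff_rpow_le (by norm_num) (by positivity), Real.rpow_one]
  exact_mod_cast hN

theorem clog_two_le (hN : 2 ≤ N) : (Nat.clog 2 N : ℝ) ≤ Real.logb 2 N + 1 := by
  rw [← Real.natCeil_logb_natCast]
  exact (Nat.ceil_lt_add_one (zero_le_one.trans (one_le_logb_two hN))).le

theorem two_rpow_mul_logb (hN : 2 ≤ N) (k : ℕ) :
    (2 : ℝ) ^ ((k : ℝ) * Real.logb 2 N) = (N : ℝ) ^ k := by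
  rw [mul_comm, Real.rpow_mul (by norm_num), Real.rpow_logb (by norm_num) (by norm_num)
    (by positivity), Real.rpow_natCast]

/-- The constant is `132 = 22 * 6`: 22 sub-phases halve the expected number of crowded workers. -/
theorem drift_pow_le (hN : 2 ≤ N) :
    (31 / 32 : ℝ) ^ ⌈(132 : ℝ) * Real.logb 2 N⌉₊ ≤ 1 / (N : ℝ) ^ 6 := by
  have h1 : (31 / 32 : ℝ) ^ 22 ≤ 2⁻¹ := by norm_num
  have hl := one_le_logb_two hN
  calc (31 / 32 : ℝ) ^ ⌈(132 : ℝ) * Real.logb 2 N⌉₊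
      = (31 / 32 : ℝ) ^ (⌈(132 : ℝ) * Real.logb 2 N⌉₊ : ℝ) := (Real.rpow_natCast _ _).symm
    _ ≤ (31 / 32 : ℝ) ^ (((22 : ℕ) : ℝ) * (((6 : ℕ) : ℝ) * Real.logb 2 N)) := by
        refine Real.rpow_le_rpow_of_exponent_ge (by norm_num) (by norm_num) ?_
        refine le_trans (le_of_eq ?_) (Nat.le_ceil _)
        push_cast
        ring
    _ = ((31 / 32 : ℝ) ^ 22) ^ (((6 : ℕ) : ℝ) * Real.logb 2 N) := by
        rw [Real.rpow_mul (by norm_num), Real.rpow_natCast]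
    _ ≤ (2⁻¹ : ℝ) ^ (((6 : ℕ) : ℝ) * Real.logb 2 N) :=
        Real.rpow_le_rpow (by norm_num) h1 (by positivity)
    _ = 1 / (N : ℝ) ^ 6 := by
        rw [Real.inv_rpow (by norm_num), two_rpow_mul_logb hN, one_div]

theorem pow_le_two_pow_ceil (hN : 2 ≤ N) :
    (N : ℝ) ^ 20 ≤ 2 ^ ⌈(20 : ℝ) * Real.logb 2 N⌉₊ := by
  rw [← two_rpow_mul_logb hN 20, ← Real.rpow_natCast 2 ⌈_⌉₊]
  exact Real.rpow_le_rpow_of_exponent_le (by norm_num) (by exact_mod_cast Nat.le_ceil _)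

/-- The probability of failure in a phase. -/
theorem phase_failure_le (hN : 2 ≤ N) {n : ℕ} (hn : 3 ≤ n) (hnN : n ≤ N) :
    3 * ((31 / 32 : ℝ) ^ ⌈(132 : ℝ) * Real.logb 2 N⌉₊ * n +
      ⌈(132 : ℝ) * Real.logb 2 N⌉₊ * (n * (8 / 2 ^ ⌈(20 : ℝ) * Real.logb 2 N⌉₊))) ≤
        1 / (n : ℝ) ^ 2 := by
  have hl := one_le_logb_two hN
  have hn' : (3 : ℝ) ≤ n := by exact_mod_cast hn
  have hnN' : (n : ℝ) ≤ N := by exact_mod_cast hnN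
  have hN0 : (0 : ℝ) < N := by linarith
  have hlN : Real.logb 2 N ≤ N := by
    have h1 : (N : ℝ) < 2 ^ N := by exact_mod_cast Nat.lt_two_pow_self
    rw [Real.logb_le_iff_le_rpow (by norm_num) hN0, Real.rpow_natCast]
    exact h1.le
  have hm : (⌈(132 : ℝ) * Real.logb 2 N⌉₊ : ℝ) ≤ 133 * N := by
    have := (Nat.ceil_lt_add_one (by positivity : (0 : ℝ) ≤ 132 * Real.logb 2 N)).le
    linarith
  have h1 : (31 / 32 : ℝ) ^ ⌈(132 : ℝ) * Real.logb 2 N⌉₊ * n ≤ 1 / (n : ℝ) ^ 5 := by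
    calc _ ≤ 1 / (N : ℝ) ^ 6 * n := by
          gcongr
          exact drift_pow_le hN
      _ ≤ 1 / (n : ℝ) ^ 6 * n := by gcongr
      _ = _ := by field_simp
  have h2 : (⌈(132 : ℝ) * Real.logb 2 N⌉₊ : ℝ) *
      (n * (8 / 2 ^ ⌈(20 : ℝ) * Real.logb 2 N⌉₊)) ≤ 1064 / (n : ℝ) ^ 18 := by
    calc _ ≤ 133 * (N : ℝ) * (N * (8 / (N : ℝ) ^ 20)) := by
          gcongr
          exact pow_le_two_pow_ceil hN
      _ = 1064 / (N : ℝ) ^ 18 := by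
          field_simp
          norm_num
      _ ≤ _ := by gcongr
  -- Since `n ≥ 3`, each error term is at most `1 / 27` of `1 / n ^ 2`, which leaves room for the
  -- factor 3.
  have h3 : 1 / (n : ℝ) ^ 5 ≤ 1 / 27 * (1 / (n : ℝ) ^ 2) := by
    have h := pow_le_pow_left₀ (by norm_num) hn' 3
    rw [div_mul_div_comm, div_le_div_iff₀ (by positivity) (by positivity)]
    nlinarith [pow_pos (by linarith : (0 : ℝ) < n) 2]
  have h4 : 1064 / (n : ℝ) ^ 18 ≤ 1 / 27 * (1 / (n : ℝ) ^ 2) := by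
    have h := pow_le_pow_left₀ (by norm_num) hn' 16
    rw [div_mul_div_comm, div_le_div_iff₀ (by positivity) (by positivity)]
    nlinarith [pow_pos (by linarith : (0 : ℝ) < n) 2]
  have h5 : 0 < 1 / (n : ℝ) ^ 2 := by positivity
  linarith

end Logarithms

/-- A length of order `x² log N` with `x` of order `log³ N` gives the exponent 7. -/
theorem exists_isSSF_of_constants {b : ℝ} (hb : 0 < b) {N : ℕ} (hN : 2 ≤ N) :
    ∃ S : List (Finset ℕ), IsSSF N ⌈b * Real.logb 2 N ^ 3⌉₊ S ∧
      (S.length : ℝ) ≤ 10 * (b + 1) ^ 2 * Real.logb 2 N ^ 7 := by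
  have hl := one_le_logb_two hN
  set l := Real.logb 2 N
  have hx : 0 < ⌈b * l ^ 3⌉₊ := Nat.ceil_pos.mpr (by positivity)
  obtain ⟨S, hS, hlen⟩ := exists_isSSF N ⌈b * l ^ 3⌉₊ hx
  refine ⟨S, hS, ?_⟩
  set x := ⌈b * l ^ 3⌉₊
  have hx1 : (1 : ℝ) ≤ x := by exact_mod_cast hx
  have hl3 : 1 ≤ l ^ 3 := one_le_pow₀ hl
  have hxb : (x : ℝ) ≤ (b + 1) * l ^ 3 := by
    have := (Nat.ceil_lt_add_one (by positivity : (0 : ℝ) ≤ b * l ^ 3)).le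
    linarith
  have hclog : (Nat.clog 2 N : ℝ) ≤ 2 * l := (clog_two_le hN).trans (by linarith)
  calc (S.length : ℝ) ≤ ((x + 1) * Nat.clog 2 N + 1) * (2 * x) := by exact_mod_cast hlen
    _ ≤ ((x + x) * (2 * l) + x * l) * (2 * x) := by
        gcongr
        exact one_le_mul_of_one_le_of_one_le hx1 hl
    _ = 10 * (x : ℝ) ^ 2 * l := by ring
    _ ≤ 10 * ((b + 1) * l ^ 3) ^ 2 * l := by gcongr
    _ = _ := by ring

/-- The hitting set has size `O(g log |S|)`, which is `O(log² N)` even with the crude bound `log l ≤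
l`, so the cube leaves room. -/
theorem exists_broadcasts (M : SINRModel) : ∃ b : ℝ, 0 < b ∧ ∀ {N n : ℕ} (W : Network N n)
    (S : List (Finset ℕ)), 2 ≤ N → IsSSF N ⌈b * Real.logb 2 N ^ 3⌉₊ S →
      (S.length : ℝ) ≤ 10 * (b + 1) ^ 2 * Real.logb 2 N ^ 7 →
      Broadcasts M W S ⌈(20 : ℝ) * Real.logb 2 N⌉₊ := by
  obtain ⟨K, hK1, hK⟩ := exists_local_broadcast M
  obtain ⟨b, hb0, hb⟩ := exists_large_constant hK1
  refine ⟨b, hb0, fun {N n} W S hN hS hlen X hX => ?_⟩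
  have hl := one_le_logb_two hN
  set l := Real.logb 2 N
  set g := ⌈(20 : ℝ) * l⌉₊
  set Lc := 10 * (b + 1) ^ 2
  have hLc : 0 < Lc := by positivity
  have hg : 1 ≤ (g : ℝ) := by exact_mod_cast (Nat.ceil_pos.mpr (by positivity) : 0 < g)
  have hgl : (g : ℝ) ≤ 21 * l := by
    have := (Nat.ceil_lt_add_one (by positivity : (0 : ℝ) ≤ 20 * l)).le
    linarith
  have hs1 : (1 : ℝ) ≤ S.length + 1 := by linarith [Nat.cast_nonneg (α := ℝ) S.length]
  have hlogs0 : 0 ≤ Real.log (S.length + 1) := Real.log_nonneg hs1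
  have hlogs : Real.log (S.length + 1) ≤ (Real.log (Lc + 1) + 7) * l := by
    have h7 : (1 : ℝ) ≤ l ^ 7 := one_le_pow₀ hl
    calc Real.log (S.length + 1) ≤ Real.log ((Lc + 1) * l ^ 7) :=
          Real.log_le_log (by positivity) (by linarith)
      _ = Real.log (Lc + 1) + 7 * Real.log l := by
          rw [Real.log_mul (by positivity) (by positivity), Real.log_pow]
          norm_num
      _ ≤ Real.log (Lc + 1) * l + 7 * l := by
          have h1 : Real.log l ≤ l := (Real.log_le_sub_one_of_pos (by linarith)).trans (by linarith)
          have h2 : 0 ≤ Real.log (Lc + 1) := Real.log_nonneg (by linarith)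
          nlinarith
      _ = _ := by ring
  have hKg : 0 < K * g := by positivity
  -- This makes `(1 - 1 / (K * g)) ^ t` at most `1 / (|S| + 1)`; the `+ 1` gives strictness and
  -- covers an empty family.
  set t := ⌈K * g * Real.log (S.length + 1)⌉₊ with ht
  refine hK N n W X g S _ t hX hS ?_ ?_
  · have h1 : ((t + 1 : ℕ) : ℝ) ≤ b * l ^ 3 := by
      push_cast
      have h2 : (t : ℝ) ≤ K * g * Real.log (S.length + 1) + 1 :=
        (Nat.ceil_lt_add_one (by positivity)).le
      have hl3 : l ^ 2 ≤ l ^ 3 := pow_le_pow_right₀ hl (by norm_num)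
      have h3 : K * g * Real.log (S.length + 1) ≤
          21 * K * (Real.log (Lc + 1) + 7) * l ^ 3 := by
        have h5 : 0 ≤ Real.log (Lc + 1) := Real.log_nonneg (by linarith)
        calc _ ≤ K * (21 * l) * ((Real.log (Lc + 1) + 7) * l) := by gcongr
          _ = 21 * K * (Real.log (Lc + 1) + 7) * l ^ 2 := by ring
          _ ≤ _ := by gcongr
      have h4 : (1 : ℝ) ≤ l ^ 3 := one_le_pow₀ hl
      calc (t : ℝ) + 1 ≤ (21 * K * (Real.log (Lc + 1) + 7) + 2) * l ^ 3 := by linarith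
        _ ≤ b * l ^ 3 := by gcongr
    exact_mod_cast h1.trans (Nat.le_ceil _)
  · have hq : 1 / (K * g) ≤ 1 := by
      rw [div_le_one hKg]
      exact one_le_mul_of_one_le_of_one_le hK1 hg
    have h1 : (1 - 1 / (K * g)) ^ t ≤ 1 / (S.length + 1 : ℝ) := by
      calc (1 - 1 / (K * g)) ^ t ≤ Real.exp (-(1 / (K * g))) ^ t :=
            pow_le_pow_left₀ (by linarith) (Real.one_sub_le_exp_neg _) t
        _ = Real.exp (-(t / (K * g))) := by
            rw [← Real.exp_nat_mul]
            congr 1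
            ring
        _ ≤ Real.exp (-Real.log (S.length + 1)) := by
            refine Real.exp_le_exp.mpr (neg_le_neg ?_)
            rw [le_div_iff₀ hKg, mul_comm]
            exact Nat.le_ceil _
        _ = _ := by rw [Real.exp_neg, Real.exp_log (by linarith), one_div]
    calc _ ≤ 1 / (S.length + 1 : ℝ) * S.length := by gcongr
      _ < 1 := by
        rw [one_div_mul_eq_div, div_lt_one (by linarith)]
        linarith

theorem Network.card_le {N n : ℕ} (W : Network N n) : n ≤ N := by
  have h := Finset.card_le_card_of_injOn W.name (s := Finset.univ) (t := Finset.Icc 1 N)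
    (fun v _ => W.name_mem v) W.name_injective.injOn
  simpa using h

theorem maxDeg_lt (M : SINRModel) {N n : ℕ} (W : Network N n) (h : 0 < maxDeg M W) :
    maxDeg M W < n := by
  classical
  rcases Nat.eq_zero_or_pos n with rfl | hn
  · have : maxDeg M W = 0 := by simp [maxDeg]
    omega
  · have : Nonempty (Fin n) := ⟨⟨0, hn⟩⟩
    have h1 := (commGraph M W).maxDegree_lt_card_verts
    rw [Fintype.card_fin] at h1
    rw [maxDeg]
    convert h1

/-- Termination in time, for the constant `a = 132`. -/
theorem misSWD_rounds_le (M : SINRModel) {N n : ℕ} (hN : 2 ≤ N) (W : Network N n)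
    (S : List (Finset ℕ)) {L : ℝ} (hS : (S.length : ℝ) ≤ L * Real.logb 2 N ^ 7)
    {Δ : ℕ} (hΔ : 2 ≤ Δ) {c : Config n}
    (hc : c ∈ (misSWD M W S ⌈(132 : ℝ) * Real.logb 2 N⌉₊ Δ).support) :
    (c.rounds : ℝ) ≤ 798 * L * Real.logb 2 N ^ 8 * Real.logb 2 Δ := by
  have hl := one_le_logb_two hN
  have hd := one_le_logb_two hΔ
  rw [misSWD_rounds M W S _ _ c hc]
  push_cast
  -- The constant is `798 = 3 * 133 * 2`: phases, sub-phases per phase, and executions of the family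
  -- per sub-phase.
  have h1 : (Nat.clog 2 Δ : ℝ) + 1 ≤ 3 * Real.logb 2 Δ := by linarith [clog_two_le hΔ]
  have h2 : (⌈(132 : ℝ) * Real.logb 2 N⌉₊ : ℝ) ≤ 133 * Real.logb 2 N := by
    have := (Nat.ceil_lt_add_one (by positivity : (0 : ℝ) ≤ 132 * Real.logb 2 N)).le
    linarith
  calc _ ≤ 3 * Real.logb 2 Δ *
        (133 * Real.logb 2 N * (2 * (L * Real.logb 2 N ^ 7))) := by gcongr
    _ = _ := by ring

/-- Correctness with high probability, for the constant `a = 132`. -/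
theorem le_misSWD_leadersFormMIS (M : SINRModel) {N n : ℕ} (hN : 2 ≤ N) (W : Network N n)
    (S : List (Finset ℕ)) (hS : Broadcasts M W S ⌈(20 : ℝ) * Real.logb 2 N⌉₊)
    {Δ : ℕ} (hΔ : maxDeg M W = Δ) (hΔ2 : 2 ≤ Δ) :
    ENNReal.ofReal (1 - Real.logb 2 Δ / (n : ℝ) ^ 2) ≤
      (misSWD M W S ⌈(132 : ℝ) * Real.logb 2 N⌉₊ Δ).toOuterMeasure
        {c | LeadersFormMIS M W c} := by
  have hn : 3 ≤ n := by
    have := maxDeg_lt M W (by omega)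
    omega
  have hd := one_le_logb_two hΔ2
  set m := ⌈(132 : ℝ) * Real.logb 2 N⌉₊ with hm
  set g := ⌈(20 : ℝ) * Real.logb 2 N⌉₊ with hg
  have hreal := phase_failure_le hN hn W.card_le
  rw [← hm, ← hg] at hreal
  have hcast : ((Nat.clog 2 Δ + 1 : ℕ) : ℝ≥0∞) *
      ((1 - 32⁻¹) ^ m * n + m * (n * (8 / 2 ^ g))) =
      ENNReal.ofReal ((Nat.clog 2 Δ + 1 : ℕ) *
        ((31 / 32) ^ m * n + m * (n * (8 / 2 ^ g)))) := by
    have h1 : (1 - 32⁻¹ : ℝ≥0∞) = ENNReal.ofReal (31 / 32) := by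
      rw [show (31 / 32 : ℝ) = 1 - 32⁻¹ by norm_num, ENNReal.ofReal_sub _ (by norm_num),
        ENNReal.ofReal_one, ENNReal.ofReal_inv_of_pos (by norm_num)]
      simp
    have h2 : (8 / 2 ^ g : ℝ≥0∞) = ENNReal.ofReal (8 / 2 ^ g) := by
      rw [ENNReal.ofReal_div_of_pos (by positivity), ENNReal.ofReal_pow (by norm_num)]
      simp
    rw [h1, h2, ENNReal.ofReal_mul (by positivity), ENNReal.ofReal_add (by positivity)
      (by positivity), ENNReal.ofReal_mul (by positivity), ENNReal.ofReal_mul (by positivity),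
      ENNReal.ofReal_mul (by positivity), ENNReal.ofReal_pow (by norm_num)]
    simp only [ENNReal.ofReal_natCast]
  have hfail : (misSWD M W S m Δ).toOuterMeasure {c | LeadersFormMIS M W c}ᶜ ≤
      ENNReal.ofReal (Real.logb 2 Δ / (n : ℝ) ^ 2) := by
    refine (misSWD_compl_le M W S hS m hΔ hΔ2).trans ?_
    rw [hcast]
    refine ENNReal.ofReal_le_ofReal ?_
    have h1 : ((Nat.clog 2 Δ + 1 : ℕ) : ℝ) ≤ Real.logb 2 Δ * 3 := by
      push_cast
      linarith [clog_two_le hΔ2]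
    calc _ ≤ Real.logb 2 Δ * 3 * ((31 / 32) ^ m * n + m * (n * (8 / 2 ^ g))) := by gcongr
      _ ≤ Real.logb 2 Δ * (1 / (n : ℝ) ^ 2) := by
          rw [mul_assoc]
          gcongr
      _ = _ := by rw [mul_one_div]
  rw [ENNReal.ofReal_sub _ (by positivity), ENNReal.ofReal_one, tsub_le_iff_right,
    ← toOuterMeasure_add_compl (misSWD M W S m Δ) {c | LeadersFormMIS M W c}]
  gcongr

end MisSWD

end

open MisSWD in
theorem mainTheorem2 (M : SINRModel) :
    ∃ a b L C : ℝ, 0 < a ∧ 0 < b ∧ 0 < L ∧ 0 < C ∧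
      ∀ N : ℕ, 2 ≤ N →
        (∃ S : List (Finset ℕ), IsSSF N ⌈b * Real.logb 2 N ^ 3⌉₊ S ∧
          (S.length : ℝ) ≤ L * Real.logb 2 N ^ 7) ∧
        ∀ S : List (Finset ℕ), IsSSF N ⌈b * Real.logb 2 N ^ 3⌉₊ S →
          (S.length : ℝ) ≤ L * Real.logb 2 N ^ 7 →
          ∀ (n : ℕ) (W : Network N n) (Δ : ℕ), maxDeg M W = Δ → 2 ≤ Δ →
            (∀ c ∈ (misSWD M W S ⌈a * Real.logb 2 N⌉₊ Δ).support,
              (c.rounds : ℝ) ≤ C * Real.logb 2 N ^ 8 * Real.logb 2 Δ) ∧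
            ENNReal.ofReal (1 - Real.logb 2 Δ / (n : ℝ) ^ 2) ≤
              (misSWD M W S ⌈a * Real.logb 2 N⌉₊ Δ).toOuterMeasure
                {c | LeadersFormMIS M W c} := by
  obtain ⟨b, hb, hbroad⟩ := exists_broadcasts M
  refine ⟨132, b, 10 * (b + 1) ^ 2, 798 * (10 * (b + 1) ^ 2), by norm_num, hb, by positivity,
    by positivity, fun N hN => ⟨exists_isSSF_of_constants hb hN, ?_⟩⟩
  intro S hS hlen n W Δ hΔ hΔ2
  exact ⟨fun c hc => misSWD_rounds_le M hN W S hlen hΔ2 hc,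
    le_misSWD_leadersFormMIS M hN W S (hbroad W S hN hS hlen) hΔ hΔ2⟩
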